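/- Let $k\ge 1$, let $S_k$ be the set of symmetric positive definite real $k\times k$ matrices and $M_k$ the set of all real $k\times k$ matrices. For $\mathcal V=(\mu,\Sigma,\nu)\in\mathbb R^k\times S_k\times(0,\infty)$ let $$f_{\mathcal V}(x)=\frac{\Gamma(\frac{\nu+k}{2})}{(\pi\nu)^{k/2}\,\Gamma(\frac{\nu}{2})}\,|\Sigma|^{-1/2}\Big(1+\frac{(x-\mu)'\Sigma^{-1}(x-\mu)}{\nu}\Big)^{-\frac{\nu+k}{2}},\qquad x\in\mathbb R^k,$$ be the Student $t$ density, and let $\mathrm P^{(n)}_{\mathcal V}$ be the joint distribution of $n$ independent observations $X_1,\dots,X_n$ with density $f_{\mathcal V}$. Let $\mathrm{vech}(A)$ be the vector of the upper triangular entries (diagonal included) of a matrix $A$. Define the scores $\mathcal L^{(2)}_{\mathcal V}(x)=D_{\mathrm{vech}(\Sigma)}\log f_{\mathcal V}(x)\in\mathbb R^{k(k+1)/2}$ (a gradient) and $\mathcal L^{(3)}_{\mathcal V}(x)=D_\nu\log f_{\mathcal V}(x)\in\mathbb R$, and the central sequences $\Delta^{(n)}_i(\mathcal V)=n^{-1/2}\sum_{j=1}^n\mathcal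 L^{(i)}_{\mathcal V}(X_j)$, $i=2,3$. Let $\Gamma_{22}(\mathcal V)$, $\Gamma_{23}(\mathcal V)$ and $\Gamma_{33}(\mathcal V)$ be the blocks of the Fisher information, that is, the covariance matrix of $\mathcal L^{(2)}_{\mathcal V}(X_1)$, its covariance vector with $\mathcal L^{(3)}_{\mathcal V}(X_1)$, and the variance of $\mathcal L^{(3)}_{\mathcal V}(X_1)$, when $X_1$ has density $f_{\mathcal V}$. The efficient central sequence and the efficient Fisher information for tail weight are $$\Delta_3^{(n)*}(\mathcal V)=\Delta_3^{(n)}(\mathcal V)-\Gamma_{23}(\mathcal V)'\,\Gamma_{22}(\mathcal V)^{-1}\Delta_2^{(n)}(\mathcal V),\qquad \Gamma_{33}^*(\mathcal V)=\Gamma_{33}(\mathcal V)-\Gamma_{23}(\mathcal V)'\,\Gamma_{22}(\mathcal V)^{-1}\Gamma_{23}(\mathcal V).$$ Lemma. For any $\mathcal V=(\mu,\Sigma,\nu)\in\mathbb R^k\times S_k\times(0,\infty)$ and any bounded sequence $\tau^{(n)}=(\tau_1^{(n)},\tau_2^{(n)},\tau_3^{(n)})\in\mathbb R^k\times M_k\times\mathbb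 R$ such that $\Sigma+n^{-1/2}\tau_2^{(n)}\in S_k$ and $\nu+n^{-1/2}\tau_3^{(n)}>0$ for all $n\ge1$, we have, under $\mathrm P^{(n)}_{\mathcal V}$ and as $n\to\infty$, $$\Delta_3^{(n)*}\big(\mathcal V+n^{-1/2}\tau^{(n)}\big)=\Delta_3^{(n)*}(\mathcal V)-\Gamma_{33}^*(\mathcal V)\,\tau_3^{(n)}+o_{\mathrm P}(1).$$ In particular, if $\tau_3^{(n)}=0$ for all $n\ge1$, $$\Delta_3^{(n)*}\big(\mu+n^{-1/2}\tau_1^{(n)},\Sigma+n^{-1/2}\tau_2^{(n)},\nu\big)=\Delta_3^{(n)*}(\mu,\Sigma,\nu)+o_{\mathrm P}(1).$$ -/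

import Mathlib

open MeasureTheory ProbabilityTheory Filter Topology
open scoped Matrix

noncomputable section

namespace StudentT

/-- Index set of `vech A` for a `k × k` matrix `A`: the upper triangular positions. -/
abbrev VechIdx (k : ℕ) : Type := {p : Fin k × Fin k // p.1 ≤ p.2}

/-- The upper triangular entries (diagonal included) of a square matrix. -/
def vech {k : ℕ} (A : Matrix (Fin k) (Fin k) ℝ) : VechIdx k → ℝ :=
  fun p => A p.1.1 p.1.2

/-- The symmetric matrix with given upper triangular entries. -/
def unvech {k : ℕ} (s : VechIdx k → ℝ) : Matrix (Fin k) (Fin k) ℝ :=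
  Matrix.of fun i j => s ⟨(min i j, max i j), min_le_max⟩

/-- The normalizing constant `c_{ν,k}`. -/
def normConst (k : ℕ) (ν : ℝ) : ℝ :=
  Real.Gamma ((ν + k) / 2) / ((Real.pi * ν) ^ ((k : ℝ) / 2) * Real.Gamma (ν / 2))

/-- The squared Mahalanobis distance `‖S^{-1/2} (x - μ)‖² = (x - μ)' S⁻¹ (x - μ)`. -/
def mahalanobisSq {k : ℕ} (μ : Fin k → ℝ) (S : Matrix (Fin k) (Fin k) ℝ) (x : Fin k → ℝ) : ℝ :=
  (x - μ) ⬝ᵥ (S⁻¹ *ᵥ (x - μ))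

/-- The `k`-dimensional Student `t` density with location `μ`, scatter `S`, tail weight `ν`. -/
def density {k : ℕ} (μ : Fin k → ℝ) (S : Matrix (Fin k) (Fin k) ℝ) (ν : ℝ) (x : Fin k → ℝ) : ℝ :=
  normConst k ν * S.det ^ (-(1 / 2) : ℝ)
    * (1 + mahalanobisSq μ S x / ν) ^ (-((ν + k) / 2))

/-- The Student `t` distribution on `ℝ^k`. -/
def law {k : ℕ} (μ : Fin k → ℝ) (S : Matrix (Fin k) (Fin k) ℝ) (ν : ℝ) : Measure (Fin k → ℝ) :=
  volume.withDensity fun x => ENNReal.ofReal (density μ S ν x)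

/-- The joint distribution of `n` independent observations from the Student `t` distribution. -/
def sampleLaw {k : ℕ} (n : ℕ) (μ : Fin k → ℝ) (S : Matrix (Fin k) (Fin k) ℝ) (ν : ℝ) :
    Measure (Fin n → Fin k → ℝ) :=
  Measure.pi fun _ => law μ S ν

/-- The scatter score: the gradient of the log-density with respect to `vech S`,
given by its partial derivatives. -/
def scoreScatter {k : ℕ} (μ : Fin k → ℝ) (S : Matrix (Fin k) (Fin k) ℝ) (ν : ℝ)
    (x : Fin k → ℝ) : VechIdx k → ℝ :=
  fun p => lineDeriv ℝ (fun s : VechIdx k → ℝ => Real.log (density μ (unvech s) ν x))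
    (vech S) (Pi.single p 1)

/-- The tail weight score: the derivative of the log-density with respect to `ν`. -/
def scoreTail {k : ℕ} (μ : Fin k → ℝ) (S : Matrix (Fin k) (Fin k) ℝ) (ν : ℝ)
    (x : Fin k → ℝ) : ℝ :=
  deriv (fun v : ℝ => Real.log (density μ S v x)) ν

/-- The scatter block of the Fisher information matrix (the covariance matrix of the score). -/
def Gamma22 {k : ℕ} (μ : Fin k → ℝ) (S : Matrix (Fin k) (Fin k) ℝ) (ν : ℝ) :
    Matrix (VechIdx k) (VechIdx k) ℝ :=
  Matrix.of fun p q =>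
    cov[fun x => scoreScatter μ S ν x p, fun x => scoreScatter μ S ν x q; law μ S ν]

/-- The scatter / tail weight block of the Fisher information matrix. -/
def Gamma23 {k : ℕ} (μ : Fin k → ℝ) (S : Matrix (Fin k) (Fin k) ℝ) (ν : ℝ) : VechIdx k → ℝ :=
  fun p => cov[fun x => scoreScatter μ S ν x p, scoreTail μ S ν; law μ S ν]

/-- The tail weight entry of the Fisher information matrix. -/
def Gamma33 {k : ℕ} (μ : Fin k → ℝ) (S : Matrix (Fin k) (Fin k) ℝ) (ν : ℝ) : ℝ :=
  cov[scoreTail μ S ν, scoreTail μ S ν; law μ S ν]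

/-- The efficient Fisher information for tail weight. -/
def Gamma33Star {k : ℕ} (μ : Fin k → ℝ) (S : Matrix (Fin k) (Fin k) ℝ) (ν : ℝ) : ℝ :=
  Gamma33 μ S ν - Gamma23 μ S ν ⬝ᵥ ((Gamma22 μ S ν)⁻¹ *ᵥ Gamma23 μ S ν)

/-- The scatter part of the central sequence. -/
def Delta2 {k : ℕ} (n : ℕ) (μ : Fin k → ℝ) (S : Matrix (Fin k) (Fin k) ℝ) (ν : ℝ)
    (X : Fin n → Fin k → ℝ) : VechIdx k → ℝ :=
  (√(n : ℝ))⁻¹ • ∑ i, scoreScatter μ S ν (X i)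

/-- The tail weight part of the central sequence. -/
def Delta3 {k : ℕ} (n : ℕ) (μ : Fin k → ℝ) (S : Matrix (Fin k) (Fin k) ℝ) (ν : ℝ)
    (X : Fin n → Fin k → ℝ) : ℝ :=
  (√(n : ℝ))⁻¹ * ∑ i, scoreTail μ S ν (X i)

/-- The efficient central sequence for tail weight. -/
def Delta3Star {k : ℕ} (n : ℕ) (μ : Fin k → ℝ) (S : Matrix (Fin k) (Fin k) ℝ) (ν : ℝ)
    (X : Fin n → Fin k → ℝ) : ℝ :=
  Delta3 n μ S ν X - Gamma23 μ S ν ⬝ᵥ ((Gamma22 μ S ν)⁻¹ *ᵥ Delta2 n μ S ν X)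

/-- `Z n = o_P(1)` under `P n` as `n → ∞`. -/
def IsLittleOP {E : ℕ → Type} [∀ n, MeasurableSpace (E n)] (P : ∀ n, Measure (E n))
    (Z : ∀ n, E n → ℝ) : Prop :=
  ∀ ε : ℝ, 0 < ε → Tendsto (fun n => P n {x | ε ≤ |Z n x|}) atTop (𝓝 0)

end StudentT

end

open MeasureTheory ProbabilityTheory Filter Topology
open scoped Matrix

namespace StudentT

/-! The projection defining the efficient score is explicit. The covariance of the scatter score in
a direction `E` with the tail score, and its covariance with the score in the direction `S` itself,
are both constant multiples of `tr (S⁻¹ E)`. Hence `Γ₂₂⁻¹ Γ₂₃ = -(2 / (ν (ν + k))) vech S`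
(`Gamma22_inv_mulVec_Gamma23`). With `d` the squared Mahalanobis distance and `A = ν + d`, the
efficient score is therefore `effConst k ν - (1/2) log A - (ν + k + 2) / (2 A)` (`effScore_eq`), so
it sees location and scatter only through `d`.

Choose `T` with `T Tᵀ = ν S`. In the coordinates `x = μ + T y` the observations have the rotation
invariant law with density proportional to `(1 + ‖y‖²) ^ (-(ν + k) / 2)`, and the perturbed
parameters become a point `θₙ` at distance `O(n^{-1/2})` from a fixed base point
(`isBigO_localParam_sub`). A perturbation changes `A` by a relative amount of that order, uniformly
in `y`, and `log A` and `1 / A` react only to relative changes. The score increments are thus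
bounded by `K ‖θₙ - θ₀‖` uniformly in the observation (`exists_abs_effScore_sub_le`).

This one Lipschitz bound does two things. The normalized sum of the increments has variance at most
the square of the bound, so by Chebyshev it concentrates at its mean
(`tendsto_measure_normalized_sum`). It also allows differentiation of the mean score under the
integral sign at the base point (`exists_hasFDerivAt_meanScore`). In that derivative the location
part vanishes by oddness, the scatter part by rotational symmetry and the orthogonality built into
the efficient score, and the tail part is `-Γ₃₃*`. Multiplying the first-order expansion of the mean
by `√n` gives the drift `-Γ₃₃* τ₃`. -/

/-! ### Radial integrals of powers and logarithms of `1 + ‖y‖²` -/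

theorem dotProduct_self_nonneg {k : ℕ} (y : Fin k → ℝ) : 0 ≤ y ⬝ᵥ y :=
  Finset.sum_nonneg fun _ _ => mul_self_nonneg _

theorem one_add_dotProduct_self_pos {k : ℕ} (y : Fin k → ℝ) : 0 < 1 + y ⬝ᵥ y := by
  have : 0 ≤ y ⬝ᵥ y := dotProduct_self_nonneg y
  linarith

theorem one_le_one_add_dotProduct_self {k : ℕ} (y : Fin k → ℝ) : 1 ≤ 1 + y ⬝ᵥ y := by
  have : 0 ≤ y ⬝ᵥ y := dotProduct_self_nonneg y
  linarith

theorem log_one_add_dotProduct_self_nonneg {k : ℕ} (y : Fin k → ℝ) :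
    0 ≤ Real.log (1 + y ⬝ᵥ y) :=
  Real.log_nonneg (one_le_one_add_dotProduct_self y)

@[fun_prop]
theorem continuous_dotProduct_self {k : ℕ} : Continuous fun y : Fin k → ℝ => y ⬝ᵥ y := by
  unfold dotProduct
  fun_prop

theorem lintegral_exp_neg_mul_dotProduct {k : ℕ} {s : ℝ} (hs : 0 < s) :
    ∫⁻ y : Fin k → ℝ, ENNReal.ofReal (Real.exp (-(s * (y ⬝ᵥ y)))) =
      ENNReal.ofReal ((Real.pi / s) ^ ((k : ℝ) / 2)) := by
  have hfun : ∀ y : Fin k → ℝ,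
      Real.exp (-(s * (y ⬝ᵥ y))) = ∏ i, Real.exp (-s * y i ^ 2) := by
    intro y
    rw [← Real.exp_sum, dotProduct, Finset.mul_sum, ← Finset.sum_neg_distrib]
    congr 1
    exact Finset.sum_congr rfl fun i _ => by ring
  simp_rw [hfun]
  rw [← ofReal_integral_eq_lintegral_ofReal]
  · rw [integral_fintype_prod_volume_eq_pow (fun x : ℝ => Real.exp (-s * x ^ 2)), integral_gaussian,
      Real.sqrt_eq_rpow, ← Real.rpow_natCast, ← Real.rpow_mul (by positivity)]
    simp only [Fintype.card_fin]
    congr 2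
    ring
  · exact Integrable.fintype_prod (fun _ => integrable_exp_neg_mul_sq hs)
  · exact Eventually.of_forall fun y => Finset.prod_nonneg fun i _ => (Real.exp_pos _).le

theorem ofReal_rpow_neg_eq_lintegral {a r : ℝ} (ha : 0 < a) (hr : 0 < r) :
    ENNReal.ofReal (Real.Gamma a * r ^ (-a)) =
      ∫⁻ s in Set.Ioi (0 : ℝ), ENNReal.ofReal (s ^ (a - 1) * Real.exp (-(r * s))) := by
  have h := Real.integral_rpow_mul_exp_neg_mul_Ioi ha hr
  have hpos : 0 < Real.Gamma a * r ^ (-a) :=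
    mul_pos (Real.Gamma_pos_of_pos ha) (Real.rpow_pos_of_pos hr _)
  have h' : ∫ s in Set.Ioi (0 : ℝ), s ^ (a - 1) * Real.exp (-(r * s)) =
      Real.Gamma a * r ^ (-a) := by
    rw [h, one_div, Real.inv_rpow hr.le, Real.rpow_neg hr.le, mul_comm]
  rw [← h', ofReal_integral_eq_lintegral_ofReal]
  -- A non-integrable function has integral `0` by convention, so a nonzero value of the integral
  -- proves integrability.
  · exact not_imp_comm.1 integral_undef (by rw [h']; exact hpos.ne')
  · filter_upwards [ae_restrict_mem measurableSet_Ioi] with s hs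
    exact mul_nonneg (Real.rpow_nonneg (le_of_lt hs) _) (Real.exp_pos _).le

/-- The power is a mixture of Gaussians, `Γ(a) r ^ (-a) = ∫ s ^ (a - 1) e ^ (-r s) ds`. By Tonelli
the Gaussian in `y` is integrated first and contributes `(π / s) ^ (k / 2)`; what remains is again a
Gamma integral, with parameter `a - k / 2`. -/
theorem lintegral_one_add_dotProduct_rpow_neg {k : ℕ} {a : ℝ} (ha : (k : ℝ) / 2 < a) :
    ∫⁻ y : Fin k → ℝ, ENNReal.ofReal ((1 + y ⬝ᵥ y) ^ (-a)) =
      ENNReal.ofReal (Real.pi ^ ((k : ℝ) / 2) * Real.Gamma (a - k / 2) / Real.Gamma a) := by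
  have ha0 : 0 < a := lt_of_le_of_lt (by positivity) ha
  have hΓ := Real.Gamma_pos_of_pos ha0
  have key : ENNReal.ofReal (Real.Gamma a) *
      ∫⁻ y : Fin k → ℝ, ENNReal.ofReal ((1 + y ⬝ᵥ y) ^ (-a)) =
      ENNReal.ofReal (Real.pi ^ ((k : ℝ) / 2) * Real.Gamma (a - k / 2)) := by
    rw [← lintegral_const_mul' _ _ ENNReal.ofReal_ne_top]
    simp_rw [← ENNReal.ofReal_mul hΓ.le]
    have h1 : ∀ y : Fin k → ℝ, ENNReal.ofReal (Real.Gamma a * (1 + y ⬝ᵥ y) ^ (-a)) =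
        ∫⁻ s in Set.Ioi (0 : ℝ),
          ENNReal.ofReal (s ^ (a - 1) * Real.exp (-((1 + y ⬝ᵥ y) * s))) := fun y =>
      ofReal_rpow_neg_eq_lintegral ha0 (one_add_dotProduct_self_pos y)
    simp_rw [h1]
    rw [lintegral_lintegral_swap]
    · have h2 : ∀ s ∈ Set.Ioi (0 : ℝ), ∫⁻ y : Fin k → ℝ,
          ENNReal.ofReal (s ^ (a - 1) * Real.exp (-((1 + y ⬝ᵥ y) * s))) =
          ENNReal.ofReal (Real.pi ^ ((k : ℝ) / 2)) *
            ENNReal.ofReal (s ^ (a - k / 2 - 1) * Real.exp (-(1 * s))) := by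
        intro s hs
        have hs : 0 < s := hs
        have h3 : ∀ y : Fin k → ℝ,
            ENNReal.ofReal (s ^ (a - 1) * Real.exp (-((1 + y ⬝ᵥ y) * s))) =
            ENNReal.ofReal (s ^ (a - 1) * Real.exp (-s)) *
              ENNReal.ofReal (Real.exp (-(s * (y ⬝ᵥ y)))) := by
          intro y
          rw [← ENNReal.ofReal_mul (by positivity), mul_assoc, ← Real.exp_add]
          congr 3
          ring
        simp_rw [h3]
        rw [lintegral_const_mul' _ _ ENNReal.ofReal_ne_top, lintegral_exp_neg_mul_dotProduct hs,
          ← ENNReal.ofReal_mul (by positivity), ← ENNReal.ofReal_mul (by positivity)]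
        congr 1
        have h4 : s ^ (a - k / 2 - 1) = s ^ (a - 1) / s ^ ((k : ℝ) / 2) := by
          rw [← Real.rpow_sub hs]
          congr 1
          ring
        rw [Real.div_rpow Real.pi_pos.le hs.le, h4, one_mul]
        ring
      rw [setLIntegral_congr_fun measurableSet_Ioi h2,
        lintegral_const_mul' _ _ ENNReal.ofReal_ne_top,
        ← ofReal_rpow_neg_eq_lintegral (by linarith) one_pos, ← ENNReal.ofReal_mul (by positivity)]
      simp
    · apply Measurable.aemeasurable
      apply ENNReal.measurable_ofReal.comp
      apply Measurable.mul
      · exact (measurable_snd.pow_const _)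
      · apply Real.measurable_exp.comp
        apply Measurable.neg
        apply Measurable.mul _ measurable_snd
        exact measurable_const.add (continuous_dotProduct_self.measurable.comp measurable_fst)
  rw [ENNReal.ofReal_div_of_pos hΓ, ← key, mul_comm, ENNReal.mul_div_cancel_right]
  · simpa using hΓ
  · exact ENNReal.ofReal_ne_top

theorem continuous_one_add_dotProduct_rpow {k : ℕ} (a : ℝ) :
    Continuous fun y : Fin k → ℝ => (1 + y ⬝ᵥ y) ^ a := by
  refine Continuous.rpow_const (by fun_prop) fun y => Or.inl (one_add_dotProduct_self_pos y).ne'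

theorem integrable_one_add_dotProduct_rpow_neg {k : ℕ} {a : ℝ} (ha : (k : ℝ) / 2 < a) :
    Integrable fun y : Fin k → ℝ => (1 + y ⬝ᵥ y) ^ (-a) := by
  refine ⟨(continuous_one_add_dotProduct_rpow _).aestronglyMeasurable, ?_⟩
  rw [hasFiniteIntegral_iff_ofReal, lintegral_one_add_dotProduct_rpow_neg ha]
  · exact ENNReal.ofReal_lt_top
  · exact Eventually.of_forall fun y => Real.rpow_nonneg (one_add_dotProduct_self_pos y).le _

/-- The integral of `log (1 + ‖y‖²) ^ j * (1 + ‖y‖²) ^ (-a)` over `ℝ^k`. -/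
noncomputable def logBracketIntegral (k j : ℕ) (a : ℝ) : ℝ :=
  ∫ y : Fin k → ℝ, Real.log (1 + y ⬝ᵥ y) ^ j * (1 + y ⬝ᵥ y) ^ (-a)

theorem logBracketIntegral_zero {k : ℕ} {a : ℝ} (ha : (k : ℝ) / 2 < a) :
    logBracketIntegral k 0 a =
      Real.pi ^ ((k : ℝ) / 2) * Real.Gamma (a - k / 2) / Real.Gamma a := by
  have ha0 : 0 < a := lt_of_le_of_lt (by positivity) ha
  have hΓ := Real.Gamma_pos_of_pos ha0
  have hΓ' := Real.Gamma_pos_of_pos (sub_pos.2 ha)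
  simp only [logBracketIntegral, pow_zero, one_mul]
  rw [integral_eq_lintegral_of_nonneg_ae, lintegral_one_add_dotProduct_rpow_neg ha,
    ENNReal.toReal_ofReal (by positivity)]
  · exact Eventually.of_forall fun y => Real.rpow_nonneg (one_add_dotProduct_self_pos y).le _
  · exact (continuous_one_add_dotProduct_rpow _).aestronglyMeasurable

theorem logBracketIntegral_zero_pos {k : ℕ} {a : ℝ} (ha : (k : ℝ) / 2 < a) :
    0 < logBracketIntegral k 0 a := by
  have ha0 : 0 < a := lt_of_le_of_lt (by positivity) ha
  have hΓ := Real.Gamma_pos_of_pos ha0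
  have hΓ' := Real.Gamma_pos_of_pos (sub_pos.2 ha)
  rw [logBracketIntegral_zero ha]
  positivity

theorem logBracketIntegral_zero_add_one {k : ℕ} {a : ℝ} (ha : (k : ℝ) / 2 < a) :
    logBracketIntegral k 0 (a + 1) = logBracketIntegral k 0 a * ((a - k / 2) / a) := by
  have ha0 : 0 < a := lt_of_le_of_lt (by positivity) ha
  have hΓ := Real.Gamma_pos_of_pos ha0
  rw [logBracketIntegral_zero ha, logBracketIntegral_zero (by linarith),
    show a + 1 - (k : ℝ) / 2 = (a - k / 2) + 1 by ring, Real.Gamma_add_one ha0.ne',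
    Real.Gamma_add_one (sub_pos.2 ha).ne']
  field_simp

theorem continuous_log_pow_mul_rpow {k : ℕ} (j : ℕ) (a : ℝ) :
    Continuous fun y : Fin k → ℝ => Real.log (1 + y ⬝ᵥ y) ^ j * (1 + y ⬝ᵥ y) ^ (-a) := by
  refine Continuous.mul (Continuous.pow (Continuous.log (by fun_prop) fun y =>
    (one_add_dotProduct_self_pos y).ne') _) (continuous_one_add_dotProduct_rpow _)

theorem integrable_log_pow_mul_rpow {k : ℕ} (j : ℕ) {a : ℝ} (ha : (k : ℝ) / 2 < a) :
    Integrable fun y : Fin k → ℝ => Real.log (1 + y ⬝ᵥ y) ^ j * (1 + y ⬝ᵥ y) ^ (-a) := by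
  obtain ⟨c, hc1, hc2⟩ := exists_between ha
  -- Each logarithm costs a power `ε` of the bracket. With this `ε` the `j` logarithms together
  -- leave an exponent at most `-c`, still integrable; the `+ 1` keeps the quotient meaningful at `j
  -- = 0`.
  set ε := (a - c) / (j + 1) with hε
  have hεpos : 0 < ε := div_pos (by linarith) (by positivity)
  refine Integrable.mono' (((integrable_one_add_dotProduct_rpow_neg hc1).const_mul ((1 / ε) ^ j)))
    (continuous_log_pow_mul_rpow j a).aestronglyMeasurable (Eventually.of_forall fun y => ?_)
  have hb := one_add_dotProduct_self_pos y
  have hb1 := one_le_one_add_dotProduct_self y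
  have hl := log_one_add_dotProduct_self_nonneg y
  rw [Real.norm_of_nonneg (mul_nonneg (pow_nonneg hl _) (Real.rpow_nonneg hb.le _))]
  have h1 : Real.log (1 + y ⬝ᵥ y) ≤ 1 / ε * (1 + y ⬝ᵥ y) ^ ε := by
    have := Real.log_le_rpow_div hb.le hεpos
    rw [one_div, inv_mul_eq_div]
    exact this
  calc Real.log (1 + y ⬝ᵥ y) ^ j * (1 + y ⬝ᵥ y) ^ (-a)
      ≤ (1 / ε * (1 + y ⬝ᵥ y) ^ ε) ^ j * (1 + y ⬝ᵥ y) ^ (-a) := by gcongr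
    _ = (1 / ε) ^ j * (1 + y ⬝ᵥ y) ^ (ε * j - a) := by
        rw [mul_pow, mul_assoc, ← Real.rpow_mul_natCast hb.le, ← Real.rpow_add hb]
        rfl
    _ ≤ (1 / ε) ^ j * (1 + y ⬝ᵥ y) ^ (-c) := by
        have : ε * (j + 1) = a - c := by rw [hε]; field_simp
        have h2 : ε * j - a ≤ -c := by linarith
        gcongr

theorem hasDerivAt_logBracketIntegral {k : ℕ} (j : ℕ) {a : ℝ} (ha : (k : ℝ) / 2 < a) :
    HasDerivAt (logBracketIntegral k j) (-logBracketIntegral k (j + 1) a) a := by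
  obtain ⟨c, hc1, hc2⟩ := exists_between ha
  have h := hasDerivAt_integral_of_dominated_loc_of_deriv_le (𝕜 := ℝ) (μ := volume)
    (F := fun (t : ℝ) (y : Fin k → ℝ) => Real.log (1 + y ⬝ᵥ y) ^ j * (1 + y ⬝ᵥ y) ^ (-t))
    (F' := fun (t : ℝ) (y : Fin k → ℝ) =>
      -(Real.log (1 + y ⬝ᵥ y) ^ (j + 1) * (1 + y ⬝ᵥ y) ^ (-t)))
    (x₀ := a) (s := Set.Ioi c)
    (bound := fun y => Real.log (1 + y ⬝ᵥ y) ^ (j + 1) * (1 + y ⬝ᵥ y) ^ (-c))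
    (Ioi_mem_nhds hc2)
    (Eventually.of_forall fun t => (continuous_log_pow_mul_rpow j t).aestronglyMeasurable)
    (integrable_log_pow_mul_rpow j ha)
    (continuous_log_pow_mul_rpow (j + 1) a).neg.aestronglyMeasurable
    (Eventually.of_forall fun y t ht => ?_)
    (integrable_log_pow_mul_rpow (j + 1) hc1)
    (Eventually.of_forall fun y t ht => ?_)
  · have := h.2
    rw [integral_neg] at this
    exact this
  · have hb := one_add_dotProduct_self_pos y
    have hl := log_one_add_dotProduct_self_nonneg y
    rw [norm_neg, Real.norm_of_nonneg (mul_nonneg (pow_nonneg hl _) (Real.rpow_nonneg hb.le _))]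
    have ht : c < t := ht
    gcongr
    exact one_le_one_add_dotProduct_self y
  · have hb := one_add_dotProduct_self_pos y
    have h1 := ((hasDerivAt_id t).neg.const_rpow hb).const_mul (Real.log (1 + y ⬝ᵥ y) ^ j)
    refine h1.congr_deriv ?_
    simp only [Pi.neg_apply, id]
    ring

/-- Differentiate the recursion `logBracketIntegral_zero_add_one` in `a`: each derivative brings
down one logarithm with a minus sign. -/
theorem logBracketIntegral_one_add_one {k : ℕ} {a : ℝ} (ha : (k : ℝ) / 2 < a) :
    logBracketIntegral k 1 (a + 1) =
      logBracketIntegral k 1 a * ((a - k / 2) / a) -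
        logBracketIntegral k 0 a * (k / 2 / a ^ 2) := by
  have ha0 : 0 < a := lt_of_le_of_lt (by positivity) ha
  have h1 : HasDerivAt (fun t => logBracketIntegral k 0 (t + 1))
      (-logBracketIntegral k 1 (a + 1)) a :=
    (hasDerivAt_logBracketIntegral 0 (a := a + 1) (by linarith)).comp_add_const a 1
  have h2 : HasDerivAt (fun t : ℝ => (t - k / 2) / t) (k / 2 / a ^ 2) a := by
    refine (((hasDerivAt_id a).sub_const ((k : ℝ) / 2)).div
      (hasDerivAt_id a) ha0.ne').congr_deriv ?_
    simp only [id]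
    ring
  have h3 := (hasDerivAt_logBracketIntegral 0 ha).mul h2
  have h4 : (fun t => logBracketIntegral k 0 (t + 1)) =ᶠ[𝓝 a]
      (logBracketIntegral k 0 * fun t : ℝ => (t - k / 2) / t) := by
    filter_upwards [Ioi_mem_nhds ha] with t ht
    exact logBracketIntegral_zero_add_one ht
  have := h1.unique (h3.congr_of_eventuallyEq h4)
  simp only [zero_add] at this
  linarith

/-! ### The standard spherical law and its symmetries -/

open scoped MatrixOrder Matrix.Norms.L2Operator in
theorem exists_mul_transpose_eq {k : ℕ} {S : Matrix (Fin k) (Fin k) ℝ} (hS : S.PosDef) :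
    ∃ T : Matrix (Fin k) (Fin k) ℝ, T.det ≠ 0 ∧ T * Tᵀ = S := by
  obtain ⟨B, hB⟩ := CStarAlgebra.nonneg_iff_eq_star_mul_self.mp hS.posSemidef.nonneg
  have hB' : Bᵀ * Bᵀᵀ = S := by
    rw [hB, Matrix.transpose_transpose, Matrix.star_eq_conjTranspose,
      Matrix.conjTranspose_eq_transpose_of_trivial]
  refine ⟨Bᵀ, fun h => hS.det_pos.ne' ?_, hB'⟩
  rw [← hB', Matrix.det_mul, h, zero_mul]

theorem lintegral_comp_affine {k : ℕ} (m : Fin k → ℝ) {T : Matrix (Fin k) (Fin k) ℝ}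
    (hT : T.det ≠ 0) {g : (Fin k → ℝ) → ENNReal} (hg : Measurable g) :
    ∫⁻ x, g x = ENNReal.ofReal |T.det| * ∫⁻ y, g (m + T *ᵥ y) := by
  have hmeas : Measurable (Matrix.toLin' T) :=
    (LinearMap.continuous_of_finiteDimensional (Matrix.toLin' T)).measurable
  have h2 : ∫⁻ y, g (m + T *ᵥ y) = ∫⁻ y, g (m + y) ∂(Measure.map (Matrix.toLin' T) volume) := by
    rw [lintegral_map (f := fun y => g (m + y)) (hg.comp (measurable_const_add m)) hmeas]
    rfl
  rw [h2, Real.map_matrix_volume_pi_eq_smul_volume_pi hT, lintegral_smul_measure,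
    lintegral_add_left_eq_self g m, smul_eq_mul, ← mul_assoc, ← ENNReal.ofReal_mul (abs_nonneg _),
    ← abs_mul, mul_inv_cancel₀ hT, abs_one, ENNReal.ofReal_one, one_mul]

/-- The probability measure on `ℝ^k` with density proportional to `(1 + ‖y‖²) ^ (-a)`. -/
noncomputable def stdLaw (k : ℕ) (a : ℝ) : Measure (Fin k → ℝ) :=
  volume.withDensity fun y => ENNReal.ofReal ((1 + y ⬝ᵥ y) ^ (-a) / logBracketIntegral k 0 a)

theorem measurable_stdDensity (k : ℕ) (a : ℝ) : Measurable fun y : Fin k → ℝ =>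
    ENNReal.ofReal ((1 + y ⬝ᵥ y) ^ (-a) / logBracketIntegral k 0 a) :=
  (((continuous_one_add_dotProduct_rpow _).div_const _).measurable).ennreal_ofReal

theorem stdDensity_pos {k : ℕ} {a : ℝ} (ha : (k : ℝ) / 2 < a) (y : Fin k → ℝ) :
    0 < (1 + y ⬝ᵥ y) ^ (-a) / logBracketIntegral k 0 a :=
  div_pos (Real.rpow_pos_of_pos (one_add_dotProduct_self_pos y) _) (logBracketIntegral_zero_pos ha)

theorem isProbabilityMeasure_stdLaw {k : ℕ} {a : ℝ} (ha : (k : ℝ) / 2 < a) :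
    IsProbabilityMeasure (stdLaw k a) := by
  have hJ := logBracketIntegral_zero_pos ha
  constructor
  rw [stdLaw, withDensity_apply _ MeasurableSet.univ, Measure.restrict_univ,
    ← ofReal_integral_eq_lintegral_ofReal]
  · rw [integral_div]
    have : ∫ y : Fin k → ℝ, (1 + y ⬝ᵥ y) ^ (-a) = logBracketIntegral k 0 a := by
      simp [logBracketIntegral]
    rw [this, div_self hJ.ne', ENNReal.ofReal_one]
  · exact (integrable_one_add_dotProduct_rpow_neg ha).div_const _
  · exact Eventually.of_forall fun y => (stdDensity_pos ha y).le

theorem integral_stdLaw {k : ℕ} {a : ℝ} (ha : (k : ℝ) / 2 < a) (f : (Fin k → ℝ) → ℝ) :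
    ∫ y, f y ∂(stdLaw k a) =
      (∫ y, f y * (1 + y ⬝ᵥ y) ^ (-a)) / logBracketIntegral k 0 a := by
  rw [stdLaw, integral_withDensity_eq_integral_toReal_smul (measurable_stdDensity k a)
    (Eventually.of_forall fun y => ENNReal.ofReal_lt_top), ← integral_div]
  congr 1 with y
  rw [ENNReal.toReal_ofReal (stdDensity_pos ha y).le, smul_eq_mul]
  ring

theorem integrable_stdLaw_iff {k : ℕ} {a : ℝ} (ha : (k : ℝ) / 2 < a) (f : (Fin k → ℝ) → ℝ) :
    Integrable f (stdLaw k a) ↔ Integrable fun y => f y * (1 + y ⬝ᵥ y) ^ (-a) := by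
  rw [stdLaw, integrable_withDensity_iff_integrable_smul' (measurable_stdDensity k a)
    (Eventually.of_forall fun y => ENNReal.ofReal_lt_top)]
  have hJ := logBracketIntegral_zero_pos ha
  rw [← integrable_const_mul_iff (c := (logBracketIntegral k 0 a)⁻¹)
    (f := fun y => f y * (1 + y ⬝ᵥ y) ^ (-a)) (isUnit_iff_ne_zero.2 (inv_pos.2 hJ).ne')]
  refine integrable_congr (Eventually.of_forall fun y => ?_)
  simp only [ENNReal.toReal_ofReal (stdDensity_pos ha y).le, smul_eq_mul]
  ring

/-- Mixed moments of `log (1 + ‖Y‖²)` and powers of `(1 + ‖Y‖²)⁻¹`. -/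
theorem integral_log_pow_mul_inv_pow {k : ℕ} {a : ℝ} (ha : (k : ℝ) / 2 < a) (j m : ℕ) :
    ∫ y, Real.log (1 + y ⬝ᵥ y) ^ j * (1 + y ⬝ᵥ y)⁻¹ ^ m ∂(stdLaw k a) =
      logBracketIntegral k j (a + m) / logBracketIntegral k 0 a := by
  rw [integral_stdLaw ha, logBracketIntegral]
  congr 2 with y
  have hb := one_add_dotProduct_self_pos y
  rw [mul_assoc]
  congr 1
  rw [neg_add, Real.rpow_add hb, Real.rpow_neg hb.le (m : ℝ), Real.rpow_natCast, inv_pow, mul_comm]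

theorem integrable_log_pow_mul_inv_pow {k : ℕ} {a : ℝ} (ha : (k : ℝ) / 2 < a) (j m : ℕ) :
    Integrable (fun y => Real.log (1 + y ⬝ᵥ y) ^ j * (1 + y ⬝ᵥ y)⁻¹ ^ m) (stdLaw k a) := by
  rw [integrable_stdLaw_iff ha]
  refine (integrable_log_pow_mul_rpow j (a := a + m) ?_).congr (Eventually.of_forall fun y => ?_)
  · have : (0 : ℝ) ≤ m := by positivity
    linarith
  have hb := one_add_dotProduct_self_pos y
  simp only
  rw [mul_assoc]
  congr 1
  rw [neg_add, Real.rpow_add hb, Real.rpow_neg hb.le (m : ℝ), Real.rpow_natCast, inv_pow, mul_comm]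

theorem measurable_affine {k : ℕ} (m : Fin k → ℝ) (T : Matrix (Fin k) (Fin k) ℝ) :
    Measurable fun y : Fin k → ℝ => m + T *ᵥ y :=
  measurable_const.add (LinearMap.continuous_of_finiteDimensional (Matrix.toLin' T)).measurable

/-- An orthogonal matrix has determinant of absolute value `1` and preserves `y ⬝ᵥ y`, on which
alone the density depends. -/
theorem stdLaw_map_mulVec {k : ℕ} (a : ℝ) {T : Matrix (Fin k) (Fin k) ℝ} (hT : Tᵀ * T = 1) :
    (stdLaw k a).map (fun y => T *ᵥ y) = stdLaw k a := by
  have hdet : |T.det| = 1 := by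
    have h := congrArg Matrix.det hT
    rw [Matrix.det_mul, Matrix.det_transpose, Matrix.det_one] at h
    have : |T.det| * |T.det| = 1 := by rw [← abs_mul, h, abs_one]
    nlinarith [abs_nonneg T.det]
  have hdet0 : T.det ≠ 0 := fun h => by simp [h] at hdet
  have hmeas : Measurable fun y : Fin k → ℝ => T *ᵥ y := by
    simpa using measurable_affine 0 T
  have hinv : ∀ y : Fin k → ℝ, (T *ᵥ y) ⬝ᵥ (T *ᵥ y) = y ⬝ᵥ y := by
    intro y
    rw [Matrix.dotProduct_mulVec, Matrix.vecMul_mulVec, ← Matrix.dotProduct_mulVec, hT,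
      Matrix.one_mulVec]
  ext s hs
  rw [Measure.map_apply hmeas hs, stdLaw, withDensity_apply _ hs,
    withDensity_apply _ (hmeas hs), ← lintegral_indicator hs, ← lintegral_indicator (hmeas hs),
    lintegral_comp_affine 0 hdet0 ((measurable_stdDensity k a).indicator hs), hdet]
  simp only [ENNReal.ofReal_one, one_mul, zero_add]
  refine lintegral_congr fun y => ?_
  by_cases h : T *ᵥ y ∈ s
  · have h' : y ∈ (fun y => T *ᵥ y) ⁻¹' s := h
    rw [Set.indicator_of_mem h', Set.indicator_of_mem h, hinv]
  · have h' : y ∉ (fun y => T *ᵥ y) ⁻¹' s := h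
    rw [Set.indicator_of_notMem h', Set.indicator_of_notMem h]

theorem integral_stdLaw_comp_mulVec {k : ℕ} (a : ℝ) {T : Matrix (Fin k) (Fin k) ℝ}
    (hT : Tᵀ * T = 1) {f : (Fin k → ℝ) → ℝ} (hf : Measurable f) :
    ∫ y, f (T *ᵥ y) ∂(stdLaw k a) = ∫ y, f y ∂(stdLaw k a) := by
  have hmeas : Measurable fun y : Fin k → ℝ => T *ᵥ y := by
    simpa using measurable_affine 0 T
  conv_rhs => rw [← stdLaw_map_mulVec a hT]
  rw [integral_map hmeas.aemeasurable hf.aestronglyMeasurable]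

/-- Odd functions integrate to zero. -/
theorem integral_stdLaw_odd {k : ℕ} (a : ℝ) {f : (Fin k → ℝ) → ℝ} (hf : Measurable f)
    (hodd : ∀ y, f (-y) = -f y) : ∫ y, f y ∂(stdLaw k a) = 0 := by
  have h := integral_stdLaw_comp_mulVec a (T := -1) (by simp) hf
  simp only [Matrix.neg_mulVec, Matrix.one_mulVec, hodd, integral_neg] at h
  linarith

/-- Reflecting the `i`-th coordinate changes the sign of the integrand and preserves the law. -/
theorem integral_mul_coord_ne {k : ℕ} (a : ℝ) {φ : ℝ → ℝ} (hφ : Measurable φ) {i j : Fin k}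
    (hij : i ≠ j) : ∫ y, y i * y j * φ (y ⬝ᵥ y) ∂(stdLaw k a) = 0 := by
  set D : Matrix (Fin k) (Fin k) ℝ := Matrix.diagonal fun l => if l = i then -1 else 1 with hD
  have hDD : Dᵀ * D = 1 := by
    rw [hD, Matrix.diagonal_transpose, Matrix.diagonal_mul_diagonal, ← Matrix.diagonal_one]
    congr 1
    ext l
    split_ifs <;> simp
  have hDy : ∀ y : Fin k → ℝ, (D *ᵥ y) ⬝ᵥ (D *ᵥ y) = y ⬝ᵥ y := by
    intro y
    rw [Matrix.dotProduct_mulVec, Matrix.vecMul_mulVec, ← Matrix.dotProduct_mulVec, hDD,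
      Matrix.one_mulVec]
  have hf : Measurable fun y : Fin k → ℝ => y i * y j * φ (y ⬝ᵥ y) :=
    ((measurable_pi_apply i).mul (measurable_pi_apply j)).mul
      (hφ.comp continuous_dotProduct_self.measurable)
  have h := integral_stdLaw_comp_mulVec a hDD hf
  simp only [hDy] at h
  simp only [hD, Matrix.mulVec_diagonal, if_true, if_neg hij.symm, neg_mul, one_mul,
    integral_neg] at h
  linarith

/-- Coordinates are exchangeable: the transposition of `i` and `j` acts by an orthogonal matrix. -/
theorem integral_sq_coord_eq {k : ℕ} (a : ℝ) {φ : ℝ → ℝ} (hφ : Measurable φ) (i j : Fin k) :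
    ∫ y, y i * y i * φ (y ⬝ᵥ y) ∂(stdLaw k a) = ∫ y, y j * y j * φ (y ⬝ᵥ y) ∂(stdLaw k a) := by
  set P : Matrix (Fin k) (Fin k) ℝ := (Equiv.swap i j).permMatrix ℝ with hP
  have hPy : ∀ y : Fin k → ℝ, P *ᵥ y = y ∘ Equiv.swap i j := fun y =>
    Matrix.permMatrix_mulVec _
  have hPP : Pᵀ * P = 1 := by
    rw [hP, Matrix.transpose_permMatrix, ← Matrix.permMatrix_mul]
    simp
  have hPy' : ∀ y : Fin k → ℝ, (P *ᵥ y) ⬝ᵥ (P *ᵥ y) = y ⬝ᵥ y := by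
    intro y
    rw [Matrix.dotProduct_mulVec, Matrix.vecMul_mulVec, ← Matrix.dotProduct_mulVec, hPP,
      Matrix.one_mulVec]
  have hf : Measurable fun y : Fin k → ℝ => y j * y j * φ (y ⬝ᵥ y) :=
    ((measurable_pi_apply j).mul (measurable_pi_apply j)).mul
      (hφ.comp continuous_dotProduct_self.measurable)
  have h := integral_stdLaw_comp_mulVec a hPP hf
  simp only [hPy'] at h
  simpa only [hPy, Function.comp, Equiv.swap_apply_right] using h

theorem abs_mul_coord_le {k : ℕ} (y : Fin k → ℝ) (i j : Fin k) : |y i * y j| ≤ y ⬝ᵥ y := by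
  have h : ∀ l, y l * y l ≤ y ⬝ᵥ y := fun l =>
    Finset.single_le_sum (f := fun l => y l * y l) (fun _ _ => mul_self_nonneg _)
      (Finset.mem_univ l)
  rw [abs_le]
  constructor <;> nlinarith [h i, h j, sq_nonneg (y i - y j), sq_nonneg (y i + y j)]

/-- Rotational symmetry: a quadratic form averages to its trace. -/
theorem integral_quadForm_mul_radial {k : ℕ} (a : ℝ) {φ : ℝ → ℝ} (hφ : Measurable φ)
    (hint : Integrable (fun y : Fin k → ℝ => (y ⬝ᵥ y) * φ (y ⬝ᵥ y)) (stdLaw k a))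
    (D : Matrix (Fin k) (Fin k) ℝ) :
    ∫ y, (y ⬝ᵥ (D *ᵥ y)) * φ (y ⬝ᵥ y) ∂(stdLaw k a) =
      D.trace / k * ∫ y, (y ⬝ᵥ y) * φ (y ⬝ᵥ y) ∂(stdLaw k a) := by
  have hcint : ∀ i j : Fin k,
      Integrable (fun y : Fin k → ℝ => y i * y j * φ (y ⬝ᵥ y)) (stdLaw k a) := by
    intro i j
    refine hint.mono (((measurable_pi_apply i).mul (measurable_pi_apply j)).mul
      (hφ.comp continuous_dotProduct_self.measurable)).aestronglyMeasurable
      (Eventually.of_forall fun y => ?_)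
    rw [norm_mul, norm_mul _ (φ _)]
    gcongr
    rw [Real.norm_eq_abs, Real.norm_of_nonneg (dotProduct_self_nonneg y)]
    exact abs_mul_coord_le y i j
  have hexp : ∀ y : Fin k → ℝ, (y ⬝ᵥ (D *ᵥ y)) * φ (y ⬝ᵥ y) =
      ∑ i, ∑ j, D i j * (y i * y j * φ (y ⬝ᵥ y)) := by
    intro y
    simp only [dotProduct, Matrix.mulVec, Finset.sum_mul, Finset.mul_sum]
    refine Finset.sum_congr rfl fun i _ => Finset.sum_congr rfl fun j _ => ?_
    ring
  have hexp' : ∀ y : Fin k → ℝ, (y ⬝ᵥ y) * φ (y ⬝ᵥ y) = ∑ i, y i * y i * φ (y ⬝ᵥ y) := by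
    intro y
    rw [← Finset.sum_mul]
    rfl
  simp_rw [hexp, hexp']
  rw [integral_finsetSum _ fun i _ => hcint i i, integral_finsetSum _ fun (i : Fin k) _ =>
    integrable_finsetSum _ fun (j : Fin k) _ => (hcint i j).const_mul (D i j)]
  have h0 : ∀ i : Fin k, ∫ y, ∑ j, D i j * (y i * y j * φ (y ⬝ᵥ y)) ∂(stdLaw k a) =
      ∑ j, D i j * ∫ y, y i * y j * φ (y ⬝ᵥ y) ∂(stdLaw k a) := by
    intro i
    rw [integral_finsetSum _ fun (j : Fin k) _ => (hcint i j).const_mul (D i j)]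
    simp_rw [integral_const_mul]
  simp_rw [h0]
  have h1 : ∀ i : Fin k, ∑ j, D i j * ∫ y, y i * y j * φ (y ⬝ᵥ y) ∂(stdLaw k a) =
      D i i * ∫ y, y i * y i * φ (y ⬝ᵥ y) ∂(stdLaw k a) := by
    intro i
    refine Finset.sum_eq_single i (fun j _ hj => ?_) fun h => absurd (Finset.mem_univ i) h
    rw [integral_mul_coord_ne a hφ hj.symm, mul_zero]
  simp_rw [h1]
  rcases Nat.eq_zero_or_pos k with hk | hk
  · subst hk
    simp
  · have h2 : ∀ i : Fin k, ∫ y, y i * y i * φ (y ⬝ᵥ y) ∂(stdLaw k a) =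
        ∫ y, y ⟨0, hk⟩ * y ⟨0, hk⟩ * φ (y ⬝ᵥ y) ∂(stdLaw k a) := fun i =>
      integral_sq_coord_eq a hφ i ⟨0, hk⟩
    simp_rw [h2]
    rw [← Finset.sum_mul, Finset.sum_const, Finset.card_univ, Fintype.card_fin, nsmul_eq_mul,
      Matrix.trace]
    have : (k : ℝ) ≠ 0 := by positivity
    simp only [Matrix.diag_apply]
    field_simp

/-! ### The Student law as an affine image of the standard law -/

/-- In this form the normalizing constant is differentiated in `ν` through the radial integrals, so
no digamma function appears, and its second derivative is a variance of `log (1 + ‖y‖²)` that can be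
matched with the Fisher information. -/
theorem normConst_eq {k : ℕ} {ν : ℝ} (hν : 0 < ν) :
    normConst k ν = (ν ^ ((k : ℝ) / 2) * logBracketIntegral k 0 ((ν + k) / 2))⁻¹ := by
  rw [normConst, logBracketIntegral_zero (by linarith),
    show (ν + k) / 2 - (k : ℝ) / 2 = ν / 2 by ring,
    Real.mul_rpow Real.pi_pos.le hν.le]
  have := Real.Gamma_pos_of_pos (half_pos hν)
  have := Real.Gamma_pos_of_pos (show 0 < (ν + k) / 2 by positivity)
  field_simp

theorem transpose_mul_inv_mul_eq {k : ℕ} {S T : Matrix (Fin k) (Fin k) ℝ} {ν : ℝ} (hν : 0 < ν)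
    (hT : T.det ≠ 0) (hTS : T * Tᵀ = ν • S) : Tᵀ * S⁻¹ * T = ν • 1 := by
  have hS : S = ν⁻¹ • (T * Tᵀ) := by rw [hTS, smul_smul, inv_mul_cancel₀ hν.ne', one_smul]
  have hinv : S⁻¹ = ν • (Tᵀ⁻¹ * T⁻¹) := by
    refine Matrix.inv_eq_right_inv ?_
    rw [hS, smul_mul_smul_comm, inv_mul_cancel₀ hν.ne', one_smul, Matrix.mul_assoc,
      Matrix.mul_nonsing_inv_cancel_left _ _ (by simpa using hT),
      Matrix.mul_nonsing_inv _ (by simpa using hT)]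
  rw [hinv, Matrix.mul_smul, Matrix.smul_mul, ← Matrix.mul_assoc,
    Matrix.mul_nonsing_inv _ (by simpa using hT), Matrix.one_mul,
    Matrix.nonsing_inv_mul _ (by simpa using hT)]

theorem mahalanobisSq_affine {k : ℕ} (μ : Fin k → ℝ) {S T : Matrix (Fin k) (Fin k) ℝ} {ν : ℝ}
    (hν : 0 < ν) (hT : T.det ≠ 0) (hTS : T * Tᵀ = ν • S) (y : Fin k → ℝ) :
    mahalanobisSq μ S (μ + T *ᵥ y) = ν * (y ⬝ᵥ y) := by
  rw [mahalanobisSq, add_sub_cancel_left, Matrix.mulVec_mulVec, Matrix.dotProduct_mulVec,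
    Matrix.vecMul_mulVec, ← Matrix.dotProduct_mulVec, ← Matrix.mul_assoc,
    transpose_mul_inv_mul_eq hν hT hTS, Matrix.smul_mulVec, Matrix.one_mulVec, dotProduct_smul,
    smul_eq_mul]

theorem continuous_mahalanobisSq {k : ℕ} (μ : Fin k → ℝ) (S : Matrix (Fin k) (Fin k) ℝ) :
    Continuous fun x => mahalanobisSq μ S x := by
  unfold mahalanobisSq dotProduct Matrix.mulVec dotProduct
  fun_prop

theorem measurable_density {k : ℕ} (μ : Fin k → ℝ) (S : Matrix (Fin k) (Fin k) ℝ) (ν : ℝ) :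
    Measurable fun x => density μ S ν x :=
  (((continuous_mahalanobisSq μ S).measurable.div_const _).const_add _).pow_const _ |>.const_mul _

theorem density_affine {k : ℕ} (μ : Fin k → ℝ) {S T : Matrix (Fin k) (Fin k) ℝ} {ν : ℝ}
    (hS : S.PosDef) (hν : 0 < ν) (hT : T.det ≠ 0) (hTS : T * Tᵀ = ν • S) (y : Fin k → ℝ) :
    |T.det| * density μ S ν (μ + T *ᵥ y) =
      (1 + y ⬝ᵥ y) ^ (-((ν + k) / 2)) / logBracketIntegral k 0 ((ν + k) / 2) := by
  have hJ := logBracketIntegral_zero_pos (k := k) (a := (ν + k) / 2) (by linarith)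
  -- The Jacobian is the square root of `det (T Tᵀ) = ν ^ k det S`; it cancels the scatter factor of
  -- the density and the power of `ν` in the normalizing constant.
  have hdet : |T.det| = ν ^ ((k : ℝ) / 2) * S.det ^ (1 / 2 : ℝ) := by
    have h := congrArg Matrix.det hTS
    rw [Matrix.det_mul, Matrix.det_transpose, Matrix.det_smul, Fintype.card_fin] at h
    rw [← Real.sqrt_mul_self_eq_abs, h, Real.sqrt_eq_rpow,
      Real.mul_rpow (by positivity) hS.det_pos.le, ← Real.rpow_natCast, ← Real.rpow_mul hν.le]
    congr 2
    ring
  have hd := hS.det_pos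
  rw [density, mahalanobisSq_affine μ hν hT hTS, normConst_eq hν, hdet,
    mul_div_cancel_left₀ _ hν.ne',
    Real.rpow_neg hd.le (1 / 2)]
  have h1 : 0 < ν ^ ((k : ℝ) / 2) := by positivity
  have h2 : 0 < S.det ^ (1 / 2 : ℝ) := by positivity
  generalize ν ^ ((k : ℝ) / 2) = A at *
  generalize S.det ^ (1 / 2 : ℝ) = B at *
  field_simp

/-- The Student law is an affine image of the standard law. -/
theorem law_eq_map {k : ℕ} (μ : Fin k → ℝ) {S T : Matrix (Fin k) (Fin k) ℝ} {ν : ℝ}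
    (hS : S.PosDef) (hν : 0 < ν) (hT : T.det ≠ 0) (hTS : T * Tᵀ = ν • S) :
    law μ S ν = (stdLaw k ((ν + k) / 2)).map fun y => μ + T *ᵥ y := by
  have hmeas := measurable_affine μ T
  ext s hs
  rw [Measure.map_apply hmeas hs, law, stdLaw, withDensity_apply _ hs,
    withDensity_apply _ (hmeas hs), ← lintegral_indicator hs, ← lintegral_indicator (hmeas hs),
    lintegral_comp_affine μ hT ((measurable_density μ S ν).ennreal_ofReal.indicator hs),
    ← lintegral_const_mul' _ _ ENNReal.ofReal_ne_top]
  refine lintegral_congr fun y => ?_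
  by_cases h : μ + T *ᵥ y ∈ s
  · have h' : y ∈ (fun y => μ + T *ᵥ y) ⁻¹' s := h
    rw [Set.indicator_of_mem h', Set.indicator_of_mem h, ← ENNReal.ofReal_mul (abs_nonneg _),
      density_affine μ hS hν hT hTS]
  · have h' : y ∉ (fun y => μ + T *ᵥ y) ⁻¹' s := h
    rw [Set.indicator_of_notMem h', Set.indicator_of_notMem h, mul_zero]

theorem isProbabilityMeasure_law {k : ℕ} (μ : Fin k → ℝ) {S : Matrix (Fin k) (Fin k) ℝ} {ν : ℝ}
    (hS : S.PosDef) (hν : 0 < ν) : IsProbabilityMeasure (law μ S ν) := by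
  obtain ⟨T, hT, hTS⟩ := exists_mul_transpose_eq (hS.smul hν)
  rw [law_eq_map μ hS hν hT hTS]
  have := isProbabilityMeasure_stdLaw (k := k) (a := (ν + k) / 2) (by linarith)
  exact Measure.isProbabilityMeasure_map (measurable_affine μ T).aemeasurable

/-! ### Closed forms of the scores -/

theorem unvech_vech {k : ℕ} {S : Matrix (Fin k) (Fin k) ℝ} (hS : S.IsSymm) :
    unvech (vech S) = S := by
  ext i j
  rcases le_total i j with h | h
  · simp [unvech, vech, h]
  · simpa [unvech, vech, h] using hS.apply i j

theorem vech_unvech {k : ℕ} (s : VechIdx k → ℝ) : vech (unvech s) = s := by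
  ext ⟨⟨i, j⟩, h⟩
  have h : i ≤ j := h
  simp [unvech, vech, h]

theorem unvech_isSymm {k : ℕ} (s : VechIdx k → ℝ) : (unvech s).IsSymm := by
  ext i j
  simp [unvech, min_comm, max_comm]

/-- `unvech` as a linear map. -/
def unvechLinear (k : ℕ) : (VechIdx k → ℝ) →ₗ[ℝ] Matrix (Fin k) (Fin k) ℝ where
  toFun := unvech
  map_add' _ _ := rfl
  map_smul' _ _ := rfl

theorem sum_smul_unvech_single {k : ℕ} (s : VechIdx k → ℝ) :
    ∑ p, s p • unvech (Pi.single p 1) = unvech s := by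
  have h := congrArg (unvechLinear k) (pi_eq_sum_univ' s)
  rw [map_sum] at h
  simp_rw [map_smul] at h
  exact h.symm

theorem posDef_isSymm {k : ℕ} {S : Matrix (Fin k) (Fin k) ℝ} (hS : S.PosDef) : S.IsSymm := by
  have := hS.isHermitian
  rwa [Matrix.IsHermitian, Matrix.conjTranspose_eq_transpose_of_trivial] at this

theorem mahalanobisSq_nonneg {k : ℕ} (μ : Fin k → ℝ) {S : Matrix (Fin k) (Fin k) ℝ}
    (hS : S.PosDef) (x : Fin k → ℝ) : 0 ≤ mahalanobisSq μ S x := by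
  simpa [mahalanobisSq] using hS.inv.posSemidef.dotProduct_mulVec_nonneg (x - μ)

/-- Factor out `S` and expand `det (1 + t M) = 1 + t tr M + t² P(t)` with `P` a polynomial; the last
term has zero derivative at `0`. -/
theorem hasDerivAt_det_add_smul {k : ℕ} {S : Matrix (Fin k) (Fin k) ℝ} (hS : S.det ≠ 0)
    (E : Matrix (Fin k) (Fin k) ℝ) :
    HasDerivAt (fun t : ℝ => (S + t • E).det) (S.det * (S⁻¹ * E).trace) 0 := by
  have h1 : ∀ t : ℝ, (S + t • E).det = S.det * (1 + (S⁻¹ * E).trace * t +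
      (Matrix.det (1 + (Polynomial.X : Polynomial ℝ) •
        (S⁻¹ * E).map Polynomial.C)).divX.divX.eval t * t ^ 2) := by
    intro t
    rw [← Matrix.det_one_add_smul, ← Matrix.det_mul, Matrix.mul_add, Matrix.mul_one,
      Matrix.mul_smul, Matrix.mul_nonsing_inv_cancel_left _ _ (by simpa using hS)]
  simp_rw [h1]
  set P := (Matrix.det (1 + (Polynomial.X : Polynomial ℝ) •
        (S⁻¹ * E).map Polynomial.C)).divX.divX
  have h2 := (((hasDerivAt_id (0 : ℝ)).const_mul (S⁻¹ * E).trace).const_add 1).add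
    ((P.hasDerivAt 0).mul ((hasDerivAt_id (0 : ℝ)).pow 2))
  refine (h2.const_mul S.det).congr_deriv ?_
  simp

open scoped Matrix.Norms.L2Operator in
theorem hasDerivAt_inv_add_smul {k : ℕ} {S : Matrix (Fin k) (Fin k) ℝ} (hS : S.det ≠ 0)
    (E : Matrix (Fin k) (Fin k) ℝ) (z : Fin k → ℝ) :
    HasDerivAt (fun t : ℝ => z ⬝ᵥ ((S + t • E)⁻¹ *ᵥ z)) (-(z ⬝ᵥ ((S⁻¹ * E * S⁻¹) *ᵥ z))) 0 := by
  obtain ⟨u, hu⟩ : IsUnit S := (Matrix.isUnit_iff_isUnit_det S).2 (isUnit_iff_ne_zero.2 hS)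
  have h1 : HasDerivAt (fun t : ℝ => S + t • E) E 0 := by
    simpa using ((hasDerivAt_id (0 : ℝ)).smul_const E).const_add S
  have h2 := hasFDerivAt_ringInverse (𝕜 := ℝ) u
  have h2' : HasFDerivAt Ring.inverse (-ContinuousLinearMap.mulLeftRight ℝ
      (Matrix (Fin k) (Fin k) ℝ) ↑u⁻¹ ↑u⁻¹) (S + (0 : ℝ) • E) := by
    simpa [hu] using h2
  have h3 := h2'.comp_hasDerivAt (0 : ℝ) h1
  let ℓ : Matrix (Fin k) (Fin k) ℝ →ₗ[ℝ] ℝ :=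
    { toFun := fun A => z ⬝ᵥ (A *ᵥ z)
      map_add' := fun A B => by rw [Matrix.add_mulVec, dotProduct_add]
      map_smul' := fun c A => by rw [Matrix.smul_mulVec, dotProduct_smul]; rfl }
  have h4 := (LinearMap.toContinuousLinearMap ℓ).hasFDerivAt.comp_hasDerivAt (0 : ℝ) h3
  have hui : (↑u⁻¹ : Matrix (Fin k) (Fin k) ℝ) = S⁻¹ := by
    rw [← hu, Matrix.coe_units_inv]
  refine (h4.congr_deriv ?_).congr_of_eventuallyEq (Eventually.of_forall fun t => ?_)
  · rw [hui]
    change z ⬝ᵥ ((-(S⁻¹ * E * S⁻¹)) *ᵥ z) = _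
    rw [Matrix.neg_mulVec, dotProduct_neg]
  · change z ⬝ᵥ ((S + t • E)⁻¹ *ᵥ z) = z ⬝ᵥ (Ring.inverse (S + t • E) *ᵥ z)
    rw [Matrix.nonsing_inv_eq_ringInverse]

open scoped Matrix.Norms.L2Operator in
theorem continuousAt_matrix_inv {k : ℕ} {S : Matrix (Fin k) (Fin k) ℝ} (hS : S.det ≠ 0) :
    ContinuousAt (fun A : Matrix (Fin k) (Fin k) ℝ => A⁻¹) S := by
  obtain ⟨u, hu⟩ : IsUnit S := (Matrix.isUnit_iff_isUnit_det S).2 (isUnit_iff_ne_zero.2 hS)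
  have h := (hasFDerivAt_ringInverse (𝕜 := ℝ) u).continuousAt
  rw [hu] at h
  have h' : (fun A : Matrix (Fin k) (Fin k) ℝ => A⁻¹) = Ring.inverse :=
    funext fun A => Matrix.nonsing_inv_eq_ringInverse A
  rwa [h']

theorem hasDerivAt_log_density_add_smul {k : ℕ} (μ : Fin k → ℝ) {S : Matrix (Fin k) (Fin k) ℝ}
    {ν : ℝ} (hS : S.PosDef) (hν : 0 < ν) (E : Matrix (Fin k) (Fin k) ℝ) (x : Fin k → ℝ) :
    HasDerivAt (fun t : ℝ => Real.log (density μ (S + t • E) ν x))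
      (1 / 2 * ((ν + k) / (ν + mahalanobisSq μ S x) *
        ((S⁻¹ *ᵥ (x - μ)) ⬝ᵥ (E *ᵥ (S⁻¹ *ᵥ (x - μ)))) - (S⁻¹ * E).trace)) 0 := by
  have hdet := hasDerivAt_det_add_smul hS.det_pos.ne' E
  have hinv := hasDerivAt_inv_add_smul hS.det_pos.ne' E (x - μ)
  have hd := mahalanobisSq_nonneg μ hS x
  have hnc : 0 < normConst k ν := by
    rw [normConst_eq hν]
    have := logBracketIntegral_zero_pos (k := k) (a := (ν + k) / 2) (by linarith)
    positivity
  have hD0 : (S + (0 : ℝ) • E).det = S.det := by simp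
  have hQ0 : (x - μ) ⬝ᵥ ((S + (0 : ℝ) • E)⁻¹ *ᵥ (x - μ)) = mahalanobisSq μ S x := by
    simp [mahalanobisSq]
  have hB0 : 0 < 1 + mahalanobisSq μ S x / ν := by positivity
  have hbr := (hinv.div_const ν).const_add 1
  -- The logarithm splits only where the determinant and the bracket are positive. Both conditions
  -- are open and hold at `t = 0`, so positive definiteness along the line is not required.
  have hev : (fun t : ℝ => Real.log (density μ (S + t • E) ν x)) =ᶠ[𝓝 0] fun t =>
      Real.log (normConst k ν) + (-(1 / 2)) * Real.log (S + t • E).det +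
        (-((ν + k) / 2)) *
          Real.log (1 + (x - μ) ⬝ᵥ ((S + t • E)⁻¹ *ᵥ (x - μ)) / ν) := by
    have e1 : ∀ᶠ t in 𝓝 (0 : ℝ), 0 < (S + t • E).det :=
      hdet.continuousAt.eventually (lt_mem_nhds (by simp only [hD0]; exact hS.det_pos))
    have e2 : ∀ᶠ t in 𝓝 (0 : ℝ), 0 < 1 + (x - μ) ⬝ᵥ ((S + t • E)⁻¹ *ᵥ (x - μ)) / ν :=
      hbr.continuousAt.eventually (lt_mem_nhds (by simp only [hQ0]; exact hB0))
    filter_upwards [e1, e2] with t h1 h2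
    rw [density, mahalanobisSq, Real.log_mul (by positivity) (by positivity),
      Real.log_mul (by positivity) (by positivity), Real.log_rpow h1, Real.log_rpow h2]
  have hmain := ((((hdet.log (by rw [hD0]; exact hS.det_pos.ne')).const_mul
    (-(1 / 2 : ℝ))).const_add (Real.log (normConst k ν))).add
      ((hbr.log (by rw [hQ0]; exact hB0.ne')).const_mul (-((ν + k) / 2))))
  refine (hmain.congr_of_eventuallyEq hev).congr_deriv ?_
  have hw : (x - μ) ⬝ᵥ ((S⁻¹ * E * S⁻¹) *ᵥ (x - μ)) =
      (S⁻¹ *ᵥ (x - μ)) ⬝ᵥ (E *ᵥ (S⁻¹ *ᵥ (x - μ))) := by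
    rw [← Matrix.mulVec_mulVec, ← Matrix.mulVec_mulVec, Matrix.dotProduct_mulVec,
      ← Matrix.mulVec_transpose, Matrix.transpose_nonsing_inv, (posDef_isSymm hS).eq]
  rw [hD0, hQ0, hw, mul_div_cancel_left₀ _ hS.det_pos.ne']
  have : 0 < ν + mahalanobisSq μ S x := by positivity
  field_simp
  ring

theorem scoreScatter_eq {k : ℕ} (μ : Fin k → ℝ) {S : Matrix (Fin k) (Fin k) ℝ} {ν : ℝ}
    (hS : S.PosDef) (hν : 0 < ν) (x : Fin k → ℝ) (p : VechIdx k) :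
    scoreScatter μ S ν x p = 1 / 2 * ((ν + k) / (ν + mahalanobisSq μ S x) *
        ((S⁻¹ *ᵥ (x - μ)) ⬝ᵥ (unvech (Pi.single p 1) *ᵥ (S⁻¹ *ᵥ (x - μ)))) -
        (S⁻¹ * unvech (Pi.single p 1)).trace) := by
  have h := (hasDerivAt_log_density_add_smul μ hS hν (unvech (Pi.single p 1)) x).deriv
  rw [← h, scoreScatter, lineDeriv]
  congr 1
  ext t
  congr 2
  conv_rhs => rw [← unvech_vech (posDef_isSymm hS)]
  rfl

/-- A linear combination of the scatter scores is the directional score. -/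
theorem dotProduct_scoreScatter {k : ℕ} (μ : Fin k → ℝ) {S : Matrix (Fin k) (Fin k) ℝ} {ν : ℝ}
    (hS : S.PosDef) (hν : 0 < ν) (x : Fin k → ℝ) (s : VechIdx k → ℝ) :
    s ⬝ᵥ scoreScatter μ S ν x = 1 / 2 * ((ν + k) / (ν + mahalanobisSq μ S x) *
        ((S⁻¹ *ᵥ (x - μ)) ⬝ᵥ (unvech s *ᵥ (S⁻¹ *ᵥ (x - μ)))) - (S⁻¹ * unvech s).trace) := by
  rw [← sum_smul_unvech_single s, dotProduct, Matrix.mul_sum, Matrix.trace_sum, Matrix.sum_mulVec,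
    dotProduct_sum, Finset.mul_sum, ← Finset.sum_sub_distrib, Finset.mul_sum]
  refine Finset.sum_congr rfl fun p _ => ?_
  rw [scoreScatter_eq μ hS hν, Matrix.smul_mulVec, dotProduct_smul, Matrix.mul_smul,
    Matrix.trace_smul, smul_eq_mul, smul_eq_mul]
  ring

/-- The direction `S` is a pure change of scale, so its score is radial. This is the direction onto
which the tail score projects. -/
theorem vech_dotProduct_scoreScatter {k : ℕ} (μ : Fin k → ℝ) {S : Matrix (Fin k) (Fin k) ℝ}
    {ν : ℝ} (hS : S.PosDef) (hν : 0 < ν) (x : Fin k → ℝ) :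
    vech S ⬝ᵥ scoreScatter μ S ν x =
      1 / 2 * ((ν + k) * (mahalanobisSq μ S x / (ν + mahalanobisSq μ S x)) - k) := by
  have hu : IsUnit S.det := isUnit_iff_ne_zero.2 hS.det_pos.ne'
  rw [dotProduct_scoreScatter μ hS hν, unvech_vech (posDef_isSymm hS), Matrix.mulVec_mulVec,
    Matrix.mul_nonsing_inv _ hu, Matrix.nonsing_inv_mul _ hu, Matrix.one_mulVec, Matrix.trace_one,
    Fintype.card_fin, dotProduct_comm, ← mahalanobisSq]
  ring

/-- The derivative of the logarithm of the normalizing constant. -/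
noncomputable def logNormConstDeriv (k : ℕ) (ν : ℝ) : ℝ :=
  logBracketIntegral k 1 ((ν + k) / 2) / (2 * logBracketIntegral k 0 ((ν + k) / 2)) - k / (2 * ν)

theorem hasDerivAt_half_add (k : ℕ) (ν : ℝ) :
    HasDerivAt (fun v : ℝ => (v + k) / 2) (1 / 2) ν :=
  ((hasDerivAt_id ν).add_const (k : ℝ)).div_const 2

theorem hasDerivAt_logBracketIntegral_half_add {k : ℕ} (j : ℕ) {ν : ℝ} (hν : 0 < ν) :
    HasDerivAt (fun v : ℝ => logBracketIntegral k j ((v + k) / 2))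
      (-logBracketIntegral k (j + 1) ((ν + k) / 2) * (1 / 2)) ν :=
  HasDerivAt.comp (h₂ := logBracketIntegral k j) ν
    (hasDerivAt_logBracketIntegral j (by linarith)) (hasDerivAt_half_add k ν)

theorem scoreTail_eq {k : ℕ} (μ : Fin k → ℝ) {S : Matrix (Fin k) (Fin k) ℝ} {ν : ℝ}
    (hS : S.PosDef) (hν : 0 < ν) (x : Fin k → ℝ) :
    scoreTail μ S ν x = logNormConstDeriv k ν - 1 / 2 * Real.log (1 + mahalanobisSq μ S x / ν) +
      (ν + k) / (2 * ν) * (mahalanobisSq μ S x / (ν + mahalanobisSq μ S x)) := by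
  set d := mahalanobisSq μ S x with hd_def
  have hd : 0 ≤ d := mahalanobisSq_nonneg μ hS x
  have ha : (k : ℝ) / 2 < (ν + k) / 2 := by linarith
  have hJ := logBracketIntegral_zero_pos ha
  have hev : (fun v : ℝ => Real.log (density μ S v x)) =ᶠ[𝓝 ν] fun v =>
      -((k : ℝ) / 2 * Real.log v + Real.log (logBracketIntegral k 0 ((v + k) / 2))) +
        (-(1 / 2)) * Real.log S.det + (-((v + k) / 2)) * Real.log (1 + d / v) := by
    filter_upwards [lt_mem_nhds hν] with v hv
    have hJv := logBracketIntegral_zero_pos (k := k) (a := (v + k) / 2) (by linarith)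
    have hdet := hS.det_pos
    have hb : 0 < 1 + d / v := by positivity
    rw [density, ← hd_def, normConst_eq hv, Real.log_mul (by positivity) (by positivity),
      Real.log_mul (by positivity) (by positivity), Real.log_rpow hdet, Real.log_rpow hb,
      Real.log_inv, Real.log_mul (by positivity) (by positivity), Real.log_rpow hv]
  have hb : 0 < 1 + d / ν := by positivity
  have hJd := hasDerivAt_logBracketIntegral_half_add 0 hν (k := k)
  have hbd : HasDerivAt (fun v : ℝ => 1 + d / v) (-d / ν ^ 2) ν := by
    have := ((hasDerivAt_const ν d).div (hasDerivAt_id ν) hν.ne').const_add 1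
    refine this.congr_deriv ?_
    simp
  have hmain := (((((Real.hasDerivAt_log hν.ne').const_mul ((k : ℝ) / 2)).add
    (hJd.log hJ.ne')).neg.add_const ((-(1 / 2)) * Real.log S.det)).add
      ((hasDerivAt_half_add k ν).neg.mul (hbd.log hb.ne')))
  rw [scoreTail, (hmain.congr_of_eventuallyEq hev).deriv, logNormConstDeriv]
  have : 0 < ν + d := by positivity
  simp only [zero_add, Pi.neg_apply]
  field_simp
  ring

/-! ### Covariances of radial variables and quadratic forms -/

theorem covariance_affine_affine {Ω : Type*} {mΩ : MeasurableSpace Ω} {P : Measure Ω}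
    [IsProbabilityMeasure P] {X₁ X₂ Y₁ Y₂ : Ω → ℝ} (hX₁ : MemLp X₁ 2 P) (hX₂ : MemLp X₂ 2 P)
    (hY₁ : MemLp Y₁ 2 P) (hY₂ : MemLp Y₂ 2 P) (c₀ c₁ c₂ e₀ e₁ e₂ : ℝ) :
    cov[fun ω => c₀ + (c₁ * X₁ ω + c₂ * X₂ ω), fun ω => e₀ + (e₁ * Y₁ ω + e₂ * Y₂ ω); P] =
      c₁ * e₁ * cov[X₁, Y₁; P] + c₁ * e₂ * cov[X₁, Y₂; P] +
        c₂ * e₁ * cov[X₂, Y₁; P] + c₂ * e₂ * cov[X₂, Y₂; P] := by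
  have hX := (hX₁.const_mul c₁).add (hX₂.const_mul c₂)
  have hY := (hY₁.const_mul e₁).add (hY₂.const_mul e₂)
  rw [covariance_const_add_left (X := fun ω => c₁ * X₁ ω + c₂ * X₂ ω)
      (hX.integrable one_le_two),
    covariance_const_add_right (Y := fun ω => e₁ * Y₁ ω + e₂ * Y₂ ω) (hY.integrable one_le_two)]
  change cov[(fun ω => c₁ * X₁ ω) + fun ω => c₂ * X₂ ω,
    (fun ω => e₁ * Y₁ ω) + fun ω => e₂ * Y₂ ω; P] = _
  rw [covariance_add_left (hX₁.const_mul c₁) (hX₂.const_mul c₂) hY,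
    covariance_add_right (hX₁.const_mul c₁) (hY₁.const_mul e₁) (hY₂.const_mul e₂),
    covariance_add_right (hX₂.const_mul c₂) (hY₁.const_mul e₁) (hY₂.const_mul e₂)]
  simp only [covariance_const_mul_left, covariance_const_mul_right]
  ring

section Radial

variable {k : ℕ} {a : ℝ}

theorem continuous_inv_one_add : Continuous fun y : Fin k → ℝ => (1 + y ⬝ᵥ y)⁻¹ :=
  Continuous.inv₀ (by fun_prop) fun y => (one_add_dotProduct_self_pos y).ne'

theorem continuous_log_one_add : Continuous fun y : Fin k → ℝ => Real.log (1 + y ⬝ᵥ y) :=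
  Continuous.log (by fun_prop) fun y => (one_add_dotProduct_self_pos y).ne'

theorem memLp_inv_one_add (ha : (k : ℝ) / 2 < a) :
    MemLp (fun y : Fin k → ℝ => (1 + y ⬝ᵥ y)⁻¹) 2 (stdLaw k a) := by
  rw [memLp_two_iff_integrable_sq continuous_inv_one_add.aestronglyMeasurable]
  simpa using integrable_log_pow_mul_inv_pow ha 0 2

theorem memLp_log_one_add (ha : (k : ℝ) / 2 < a) :
    MemLp (fun y : Fin k → ℝ => Real.log (1 + y ⬝ᵥ y)) 2 (stdLaw k a) := by
  rw [memLp_two_iff_integrable_sq continuous_log_one_add.aestronglyMeasurable]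
  simpa using integrable_log_pow_mul_inv_pow ha 2 0

theorem integral_inv_one_add (ha : (k : ℝ) / 2 < a) :
    ∫ y : Fin k → ℝ, (1 + y ⬝ᵥ y)⁻¹ ∂(stdLaw k a) = (a - k / 2) / a := by
  have h := integral_log_pow_mul_inv_pow ha 0 1
  have hJ := logBracketIntegral_zero_pos ha
  simp only [pow_zero, one_mul, pow_one, Nat.cast_one] at h
  rw [h, logBracketIntegral_zero_add_one ha, mul_div_cancel_left₀ _ hJ.ne']

theorem integral_inv_one_add_sq (ha : (k : ℝ) / 2 < a) :
    ∫ y : Fin k → ℝ, (1 + y ⬝ᵥ y)⁻¹ ^ 2 ∂(stdLaw k a) =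
      (a - k / 2) / a * ((a + 1 - k / 2) / (a + 1)) := by
  have h := integral_log_pow_mul_inv_pow ha 0 2
  have hJ := logBracketIntegral_zero_pos ha
  simp only [pow_zero, one_mul, Nat.cast_ofNat] at h
  rw [h, show a + 2 = a + 1 + 1 by ring, logBracketIntegral_zero_add_one (by linarith),
    logBracketIntegral_zero_add_one ha, mul_assoc, mul_div_cancel_left₀ _ hJ.ne']

theorem covariance_inv_inv (ha : (k : ℝ) / 2 < a) :
    cov[fun y : Fin k → ℝ => (1 + y ⬝ᵥ y)⁻¹, fun y => (1 + y ⬝ᵥ y)⁻¹; stdLaw k a] =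
      (a - k / 2) * (k / 2) / (a ^ 2 * (a + 1)) := by
  have := isProbabilityMeasure_stdLaw ha
  have ha0 : 0 < a := lt_of_le_of_lt (by positivity) ha
  rw [covariance_eq_sub (memLp_inv_one_add ha) (memLp_inv_one_add ha)]
  simp only [Pi.mul_apply, ← pow_two]
  rw [integral_inv_one_add ha, integral_inv_one_add_sq ha]
  field_simp
  ring

/-- The mean of the logarithm has no elementary value, but it cancels: in the recursion for the
mixed moment it is multiplied exactly by the mean of `(1 + ‖y‖²)⁻¹`. -/
theorem covariance_inv_log (ha : (k : ℝ) / 2 < a) :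
    cov[fun y : Fin k → ℝ => (1 + y ⬝ᵥ y)⁻¹, fun y => Real.log (1 + y ⬝ᵥ y); stdLaw k a] =
      -(k / 2 / a ^ 2) := by
  have := isProbabilityMeasure_stdLaw ha
  have ha0 : 0 < a := lt_of_le_of_lt (by positivity) ha
  have hJ := logBracketIntegral_zero_pos ha
  have h1 := integral_log_pow_mul_inv_pow ha 1 1
  have h2 := integral_log_pow_mul_inv_pow ha 1 0
  simp only [pow_one, Nat.cast_one, pow_zero, mul_one, Nat.cast_zero, add_zero] at h1 h2
  rw [covariance_eq_sub (memLp_inv_one_add ha) (memLp_log_one_add ha)]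
  simp only [Pi.mul_apply]
  simp_rw [mul_comm ((1 + _)⁻¹ : ℝ) (Real.log _)]
  rw [integral_inv_one_add ha, h1, h2, logBracketIntegral_one_add_one ha]
  field_simp
  ring

theorem covariance_log_log (ha : (k : ℝ) / 2 < a) :
    cov[fun y : Fin k → ℝ => Real.log (1 + y ⬝ᵥ y), fun y => Real.log (1 + y ⬝ᵥ y);
      stdLaw k a] = logBracketIntegral k 2 a / logBracketIntegral k 0 a -
        (logBracketIntegral k 1 a / logBracketIntegral k 0 a) ^ 2 := by
  have := isProbabilityMeasure_stdLaw ha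
  have h1 := integral_log_pow_mul_inv_pow ha 1 0
  have h2 := integral_log_pow_mul_inv_pow ha 2 0
  simp only [pow_one, pow_zero, mul_one, Nat.cast_zero, add_zero] at h1 h2
  rw [covariance_eq_sub (memLp_log_one_add ha) (memLp_log_one_add ha)]
  simp only [Pi.mul_apply, ← pow_two]
  rw [h1, h2]

theorem continuous_quadForm (D : Matrix (Fin k) (Fin k) ℝ) :
    Continuous fun y : Fin k → ℝ => y ⬝ᵥ (D *ᵥ y) := by
  unfold dotProduct Matrix.mulVec dotProduct
  fun_prop

theorem abs_quadForm_le (D : Matrix (Fin k) (Fin k) ℝ) (y : Fin k → ℝ) :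
    |y ⬝ᵥ (D *ᵥ y)| ≤ (∑ i, ∑ j, |D i j|) * (y ⬝ᵥ y) := by
  have h : y ⬝ᵥ (D *ᵥ y) = ∑ i, ∑ j, D i j * (y i * y j) := by
    simp only [dotProduct, Matrix.mulVec, Finset.mul_sum]
    refine Finset.sum_congr rfl fun i _ => Finset.sum_congr rfl fun j _ => by ring
  rw [h, Finset.sum_mul]
  refine (Finset.abs_sum_le_sum_abs _ _).trans (Finset.sum_le_sum fun i _ => ?_)
  rw [Finset.sum_mul]
  refine (Finset.abs_sum_le_sum_abs _ _).trans (Finset.sum_le_sum fun j _ => ?_)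
  rw [abs_mul]
  exact mul_le_mul_of_nonneg_left (abs_mul_coord_le y i j) (abs_nonneg _)

theorem dotProduct_self_mul_inv (y : Fin k → ℝ) :
    (y ⬝ᵥ y) * (1 + y ⬝ᵥ y)⁻¹ = 1 - (1 + y ⬝ᵥ y)⁻¹ := by
  have := (one_add_dotProduct_self_pos y).ne'
  field_simp
  ring

theorem memLp_quadForm_mul_inv (ha : (k : ℝ) / 2 < a) (D : Matrix (Fin k) (Fin k) ℝ) :
    MemLp (fun y : Fin k → ℝ => (y ⬝ᵥ (D *ᵥ y)) * (1 + y ⬝ᵥ y)⁻¹) 2 (stdLaw k a) := by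
  have := isProbabilityMeasure_stdLaw ha
  refine MemLp.of_bound
    ((continuous_quadForm D).mul continuous_inv_one_add).aestronglyMeasurable
    (∑ i, ∑ j, |D i j|) (Eventually.of_forall fun y => ?_)
  have hb := one_add_dotProduct_self_pos y
  rw [Real.norm_eq_abs, abs_mul, abs_of_pos (inv_pos.2 hb), ← div_eq_mul_inv, div_le_iff₀ hb]
  refine (abs_quadForm_le D y).trans (mul_le_mul_of_nonneg_left (by linarith) ?_)
  exact Finset.sum_nonneg fun i _ => Finset.sum_nonneg fun j _ => abs_nonneg _

/-- The covariance of a normalized quadratic form with a radial function. -/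
theorem covariance_quadForm_radial (ha : (k : ℝ) / 2 < a) (D : Matrix (Fin k) (Fin k) ℝ)
    {ψ : ℝ → ℝ} (hψ : Measurable ψ)
    (hψ2 : MemLp (fun y : Fin k → ℝ => ψ (y ⬝ᵥ y)) 2 (stdLaw k a)) :
    cov[fun y : Fin k → ℝ => (y ⬝ᵥ (D *ᵥ y)) * (1 + y ⬝ᵥ y)⁻¹, fun y => ψ (y ⬝ᵥ y);
      stdLaw k a] =
      -(D.trace / k) * cov[fun y : Fin k → ℝ => (1 + y ⬝ᵥ y)⁻¹, fun y => ψ (y ⬝ᵥ y);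
        stdLaw k a] := by
  have := isProbabilityMeasure_stdLaw ha
  have hb2 := memLp_inv_one_add ha
  have h1b : MemLp (fun y : Fin k → ℝ => 1 - (1 + y ⬝ᵥ y)⁻¹) 2 (stdLaw k a) :=
    (memLp_const 1).sub hb2
  have hbm : Measurable fun r : ℝ => (1 + r)⁻¹ := (measurable_id.const_add 1).inv
  have hc : cov[fun y : Fin k → ℝ => 1 - (1 + y ⬝ᵥ y)⁻¹, fun y => ψ (y ⬝ᵥ y); stdLaw k a] =
      -cov[fun y : Fin k → ℝ => (1 + y ⬝ᵥ y)⁻¹, fun y => ψ (y ⬝ᵥ y); stdLaw k a] :=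
    covariance_const_sub_left (hb2.integrable one_le_two) 1
  -- Averaging over rotations replaces the quadratic form by `tr D / k` times `‖y‖²`, both in the
  -- mean and in the product with `ψ`. Since `‖y‖² / (1 + ‖y‖²) = 1 - (1 + ‖y‖²)⁻¹`, only the
  -- covariance of the inverse bracket with `ψ` remains.
  have e1 := integral_quadForm_mul_radial a (φ := fun r => (1 + r)⁻¹) hbm (by
    simp only [dotProduct_self_mul_inv]
    exact h1b.integrable one_le_two) D
  have e2 := integral_quadForm_mul_radial a (φ := fun r => (1 + r)⁻¹ * ψ r) (hbm.mul hψ) (by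
    simp only [← mul_assoc, dotProduct_self_mul_inv]
    exact h1b.integrable_mul hψ2) D
  simp only [← mul_assoc, dotProduct_self_mul_inv] at e1 e2
  have h3 := hc
  rw [covariance_eq_sub h1b hψ2] at h3
  simp only [Pi.mul_apply] at h3
  rw [covariance_eq_sub (memLp_quadForm_mul_inv ha D) hψ2]
  simp only [Pi.mul_apply]
  rw [e1, e2]
  linear_combination (D.trace / k) * h3

end Radial

/-! ### Fisher information blocks and the efficient score -/

section Information

variable {k : ℕ} (μ : Fin k → ℝ) {S T : Matrix (Fin k) (Fin k) ℝ} {ν : ℝ}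

theorem continuous_add_mahalanobisSq_inv (hS : S.PosDef) (hν : 0 < ν) :
    Continuous fun x => (ν + mahalanobisSq μ S x)⁻¹ :=
  Continuous.inv₀ (continuous_const.add (continuous_mahalanobisSq μ S)) fun x =>
    (add_pos_of_pos_of_nonneg hν (mahalanobisSq_nonneg μ hS x)).ne'

theorem continuous_scoreScatter_dotProduct (hS : S.PosDef) (hν : 0 < ν) (s : VechIdx k → ℝ) :
    Continuous fun x => s ⬝ᵥ scoreScatter μ S ν x := by
  simp_rw [dotProduct_scoreScatter μ hS hν, div_eq_mul_inv]
  have h1 : Continuous fun x : Fin k → ℝ => S⁻¹ *ᵥ (x - μ) :=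
    (LinearMap.continuous_of_finiteDimensional (Matrix.toLin' S⁻¹)).comp
      (continuous_id.sub continuous_const)
  have h2 := (continuous_quadForm (unvech s)).comp h1
  exact continuous_const.mul (((continuous_const.mul
    (continuous_add_mahalanobisSq_inv μ hS hν)).mul h2).sub continuous_const)

theorem continuous_scoreTail (hS : S.PosDef) (hν : 0 < ν) :
    Continuous (scoreTail μ S ν) := by
  have h : scoreTail μ S ν = fun x => logNormConstDeriv k ν -
      1 / 2 * Real.log (1 + mahalanobisSq μ S x / ν) +
      (ν + k) / (2 * ν) * (mahalanobisSq μ S x * (ν + mahalanobisSq μ S x)⁻¹) :=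
    funext fun x => scoreTail_eq μ hS hν x
  rw [h]
  have hc := continuous_mahalanobisSq μ S
  refine (continuous_const.sub (continuous_const.mul (Continuous.log
    (continuous_const.add (hc.div_const _)) fun x => ?_))).add
    (continuous_const.mul (hc.mul (continuous_add_mahalanobisSq_inv μ hS hν)))
  exact (add_pos_of_pos_of_nonneg one_pos
    (div_nonneg (mahalanobisSq_nonneg μ hS x) hν.le)).ne'

/-- The matrix of the quadratic form of a scatter direction in standardized coordinates. -/
noncomputable def stdDirection (S T : Matrix (Fin k) (Fin k) ℝ) (ν : ℝ)
    (E : Matrix (Fin k) (Fin k) ℝ) : Matrix (Fin k) (Fin k) ℝ :=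
  ν⁻¹ • ((S⁻¹ * T)ᵀ * E * (S⁻¹ * T))

theorem quadForm_mulVec (A E : Matrix (Fin k) (Fin k) ℝ) (y : Fin k → ℝ) :
    (A *ᵥ y) ⬝ᵥ (E *ᵥ (A *ᵥ y)) = y ⬝ᵥ ((Aᵀ * E * A) *ᵥ y) := by
  rw [Matrix.mulVec_mulVec, Matrix.dotProduct_mulVec, Matrix.vecMul_mulVec,
    ← Matrix.dotProduct_mulVec, Matrix.mul_assoc]

/-- By cyclicity of the trace only `(S⁻¹ T) (S⁻¹ T)ᵀ = ν S⁻¹` matters, so the choice of the root `T`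
is irrelevant. -/
theorem trace_stdDirection (hS : S.PosDef) (hν : 0 < ν) (hTS : T * Tᵀ = ν • S)
    (E : Matrix (Fin k) (Fin k) ℝ) : (stdDirection S T ν E).trace = (S⁻¹ * E).trace := by
  have hu : IsUnit S.det := isUnit_iff_ne_zero.2 hS.det_pos.ne'
  have h1 : S⁻¹ * T * (S⁻¹ * T)ᵀ = ν • S⁻¹ := by
    rw [Matrix.transpose_mul, Matrix.transpose_nonsing_inv, (posDef_isSymm hS).eq,
      Matrix.mul_assoc, ← Matrix.mul_assoc T, hTS, Matrix.smul_mul, Matrix.mul_smul,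
      Matrix.mul_nonsing_inv _ hu, Matrix.mul_one]
  rw [stdDirection, Matrix.trace_smul, Matrix.mul_assoc, Matrix.trace_mul_comm, Matrix.mul_assoc,
    h1, Matrix.mul_smul, Matrix.trace_smul, smul_smul, inv_mul_cancel₀ hν.ne', one_smul,
    Matrix.trace_mul_comm]

theorem dotProduct_scoreScatter_affine (hS : S.PosDef) (hν : 0 < ν) (hT : T.det ≠ 0)
    (hTS : T * Tᵀ = ν • S) (s : VechIdx k → ℝ) (y : Fin k → ℝ) :
    s ⬝ᵥ scoreScatter μ S ν (μ + T *ᵥ y) = -(1 / 2 * (S⁻¹ * unvech s).trace) +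
      (ν + k) / 2 * ((y ⬝ᵥ (stdDirection S T ν (unvech s) *ᵥ y)) * (1 + y ⬝ᵥ y)⁻¹) := by
  have hb := one_add_dotProduct_self_pos y
  rw [dotProduct_scoreScatter μ hS hν, mahalanobisSq_affine μ hν hT hTS, add_sub_cancel_left,
    Matrix.mulVec_mulVec, quadForm_mulVec, stdDirection, Matrix.smul_mulVec, dotProduct_smul,
    smul_eq_mul]
  field_simp
  ring

theorem scoreTail_affine (hS : S.PosDef) (hν : 0 < ν) (hT : T.det ≠ 0)
    (hTS : T * Tᵀ = ν • S) (y : Fin k → ℝ) :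
    scoreTail μ S ν (μ + T *ᵥ y) = (logNormConstDeriv k ν + (ν + k) / (2 * ν)) +
      (-(1 / 2) * Real.log (1 + y ⬝ᵥ y) + -((ν + k) / (2 * ν)) * (1 + y ⬝ᵥ y)⁻¹) := by
  have hb := one_add_dotProduct_self_pos y
  rw [scoreTail_eq μ hS hν, mahalanobisSq_affine μ hν hT hTS, mul_div_cancel_left₀ _ hν.ne']
  have h : ν * (y ⬝ᵥ y) / (ν + ν * (y ⬝ᵥ y)) = 1 - (1 + y ⬝ᵥ y)⁻¹ := by
    field_simp
    ring
  rw [h]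
  ring

theorem covariance_law_eq (hS : S.PosDef) (hν : 0 < ν) (hT : T.det ≠ 0) (hTS : T * Tᵀ = ν • S)
    {F G : (Fin k → ℝ) → ℝ} (hF : Continuous F) (hG : Continuous G) :
    cov[F, G; law μ S ν] = cov[fun y => F (μ + T *ᵥ y), fun y => G (μ + T *ᵥ y);
      stdLaw k ((ν + k) / 2)] := by
  rw [law_eq_map μ hS hν hT hTS]
  exact covariance_map_fun hF.aestronglyMeasurable hG.aestronglyMeasurable
    (measurable_affine μ T).aemeasurable

theorem memLp_law_of_affine (hS : S.PosDef) (hν : 0 < ν) (hT : T.det ≠ 0)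
    (hTS : T * Tᵀ = ν • S) {F : (Fin k → ℝ) → ℝ} (hF : Continuous F)
    (h : MemLp (fun y => F (μ + T *ᵥ y)) 2 (stdLaw k ((ν + k) / 2))) :
    MemLp F 2 (law μ S ν) := by
  rw [law_eq_map μ hS hν hT hTS]
  exact (memLp_map_measure_iff hF.aestronglyMeasurable
    (measurable_affine μ T).aemeasurable).2 h

theorem memLp_scoreScatter (hS : S.PosDef) (hν : 0 < ν) (s : VechIdx k → ℝ) :
    MemLp (fun x => s ⬝ᵥ scoreScatter μ S ν x) 2 (law μ S ν) := by
  obtain ⟨T, hT, hTS⟩ := exists_mul_transpose_eq (hS.smul hν)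
  have ha : (k : ℝ) / 2 < (ν + k) / 2 := by linarith
  have := isProbabilityMeasure_stdLaw ha
  refine memLp_law_of_affine μ hS hν hT hTS (continuous_scoreScatter_dotProduct μ hS hν s) ?_
  have h0 := (memLp_const (μ := stdLaw k ((ν + k) / 2)) (p := 2)
    (-(1 / 2 * (S⁻¹ * unvech s).trace))).add
    ((memLp_quadForm_mul_inv ha (stdDirection S T ν (unvech s))).const_mul ((ν + k) / 2))
  exact h0.ae_eq (Eventually.of_forall fun y =>
    (dotProduct_scoreScatter_affine μ hS hν hT hTS s y).symm)

theorem memLp_scoreTail (hS : S.PosDef) (hν : 0 < ν) :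
    MemLp (scoreTail μ S ν) 2 (law μ S ν) := by
  obtain ⟨T, hT, hTS⟩ := exists_mul_transpose_eq (hS.smul hν)
  have ha : (k : ℝ) / 2 < (ν + k) / 2 := by linarith
  have := isProbabilityMeasure_stdLaw ha
  refine memLp_law_of_affine μ hS hν hT hTS (continuous_scoreTail μ hS hν) ?_
  have h0 := (memLp_const (μ := stdLaw k ((ν + k) / 2)) (p := 2)
    (logNormConstDeriv k ν + (ν + k) / (2 * ν))).add
    (((memLp_log_one_add ha).const_mul (-(1 / 2))).add
      ((memLp_inv_one_add ha).const_mul (-((ν + k) / (2 * ν)))))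
  exact h0.ae_eq (Eventually.of_forall fun y => (scoreTail_affine μ hS hν hT hTS y).symm)

theorem Gamma22_mulVec (hS : S.PosDef) (hν : 0 < ν) (r s : VechIdx k → ℝ) :
    r ⬝ᵥ (Gamma22 μ S ν *ᵥ s) = cov[fun x => r ⬝ᵥ scoreScatter μ S ν x,
      fun x => s ⬝ᵥ scoreScatter μ S ν x; law μ S ν] := by
  have := isProbabilityMeasure_law μ hS hν
  have hL : ∀ p : VechIdx k, MemLp (fun x => scoreScatter μ S ν x p) 2 (law μ S ν) := fun p => by
    simpa using memLp_scoreScatter μ hS hν (Pi.single p 1)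
  simp only [dotProduct, Matrix.mulVec, Gamma22, Matrix.of_apply]
  rw [covariance_fun_sum_fun_sum (X := fun p x => r p * scoreScatter μ S ν x p)
    (Y := fun q x => s q * scoreScatter μ S ν x q) (fun p => (hL p).const_mul _)
    (fun q => (hL q).const_mul _)]
  refine Finset.sum_congr rfl fun p _ => ?_
  rw [Finset.mul_sum]
  refine Finset.sum_congr rfl fun q _ => ?_
  rw [covariance_const_mul_left, covariance_const_mul_right]
  ring

theorem dotProduct_Gamma23 (hS : S.PosDef) (hν : 0 < ν) (r : VechIdx k → ℝ) :
    r ⬝ᵥ Gamma23 μ S ν = cov[fun x => r ⬝ᵥ scoreScatter μ S ν x, scoreTail μ S ν;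
      law μ S ν] := by
  have := isProbabilityMeasure_law μ hS hν
  have hL : ∀ p : VechIdx k, MemLp (fun x => scoreScatter μ S ν x p) 2 (law μ S ν) := fun p => by
    simpa using memLp_scoreScatter μ hS hν (Pi.single p 1)
  simp only [dotProduct, Gamma23]
  rw [covariance_fun_sum_left (X := fun p x => r p * scoreScatter μ S ν x p)
    (fun p => (hL p).const_mul _) (memLp_scoreTail μ hS hν)]
  refine Finset.sum_congr rfl fun p _ => ?_
  rw [covariance_const_mul_left]

theorem covariance_quadForm_inv {a : ℝ} (ha : (k : ℝ) / 2 < a) (D : Matrix (Fin k) (Fin k) ℝ) :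
    cov[fun y : Fin k → ℝ => (y ⬝ᵥ (D *ᵥ y)) * (1 + y ⬝ᵥ y)⁻¹, fun y => (1 + y ⬝ᵥ y)⁻¹;
      stdLaw k a] = -(D.trace * (a - k / 2) / (2 * a ^ 2 * (a + 1))) := by
  have ha0 : 0 < a := lt_of_le_of_lt (by positivity) ha
  rw [covariance_quadForm_radial ha D (ψ := fun r => (1 + r)⁻¹) (measurable_id.const_add 1).inv
    (memLp_inv_one_add ha), covariance_inv_inv ha]
  rcases Nat.eq_zero_or_pos k with hk | hk
  · subst hk
    simp [Matrix.trace]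
  · have : (k : ℝ) ≠ 0 := by positivity
    field_simp

theorem covariance_quadForm_log {a : ℝ} (ha : (k : ℝ) / 2 < a) (D : Matrix (Fin k) (Fin k) ℝ) :
    cov[fun y : Fin k → ℝ => (y ⬝ᵥ (D *ᵥ y)) * (1 + y ⬝ᵥ y)⁻¹,
      fun y => Real.log (1 + y ⬝ᵥ y); stdLaw k a] = D.trace / (2 * a ^ 2) := by
  have ha0 : 0 < a := lt_of_le_of_lt (by positivity) ha
  rw [covariance_quadForm_radial ha D (ψ := fun r => Real.log (1 + r))
    (Real.measurable_log.comp (measurable_id.const_add 1))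
    (memLp_log_one_add ha), covariance_inv_log ha]
  rcases Nat.eq_zero_or_pos k with hk | hk
  · subst hk
    simp [Matrix.trace]
  · have : (k : ℝ) ≠ 0 := by positivity
    field_simp

/-- In standardized coordinates the tail score is radial and the scatter score is, up to constants,
a normalized quadratic form, so rotational symmetry leaves only its trace. -/
theorem covariance_scoreScatter_scoreTail (hS : S.PosDef) (hν : 0 < ν) (s : VechIdx k → ℝ) :
    cov[fun x => s ⬝ᵥ scoreScatter μ S ν x, scoreTail μ S ν; law μ S ν] =
      -((S⁻¹ * unvech s).trace / ((ν + k) * (ν + k + 2))) := by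
  obtain ⟨T, hT, hTS⟩ := exists_mul_transpose_eq (hS.smul hν)
  have ha : (k : ℝ) / 2 < (ν + k) / 2 := by linarith
  have := isProbabilityMeasure_stdLaw ha
  rw [covariance_law_eq μ hS hν hT hTS (continuous_scoreScatter_dotProduct μ hS hν s)
    (continuous_scoreTail μ hS hν)]
  simp_rw [dotProduct_scoreScatter_affine μ hS hν hT hTS, scoreTail_affine μ hS hν hT hTS]
  have hq := memLp_quadForm_mul_inv ha (stdDirection S T ν (unvech s))
  have h := covariance_affine_affine hq hq (memLp_log_one_add ha) (memLp_inv_one_add ha)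
    (-(1 / 2 * (S⁻¹ * unvech s).trace)) ((ν + k) / 2) 0
    (logNormConstDeriv k ν + (ν + k) / (2 * ν)) (-(1 / 2)) (-((ν + k) / (2 * ν)))
  simp only [zero_mul, add_zero] at h
  rw [h, covariance_quadForm_log ha, covariance_quadForm_inv ha, trace_stdDirection hS hν hTS]
  have : 0 < ν + k := by positivity
  field_simp
  ring

theorem covariance_scoreScatter_vech (hS : S.PosDef) (hν : 0 < ν) (s : VechIdx k → ℝ) :
    cov[fun x => s ⬝ᵥ scoreScatter μ S ν x, fun x => vech S ⬝ᵥ scoreScatter μ S ν x;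
      law μ S ν] = (S⁻¹ * unvech s).trace * ν / (2 * (ν + k + 2)) := by
  obtain ⟨T, hT, hTS⟩ := exists_mul_transpose_eq (hS.smul hν)
  have ha : (k : ℝ) / 2 < (ν + k) / 2 := by linarith
  have := isProbabilityMeasure_stdLaw ha
  rw [covariance_law_eq μ hS hν hT hTS (continuous_scoreScatter_dotProduct μ hS hν s)
    (continuous_scoreScatter_dotProduct μ hS hν (vech S))]
  have hv : ∀ y : Fin k → ℝ, vech S ⬝ᵥ scoreScatter μ S ν (μ + T *ᵥ y) =
      ν / 2 + -((ν + k) / 2) * (1 + y ⬝ᵥ y)⁻¹ := by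
    intro y
    have hb := one_add_dotProduct_self_pos y
    rw [vech_dotProduct_scoreScatter μ hS hν, mahalanobisSq_affine μ hν hT hTS]
    field_simp
    ring
  simp_rw [dotProduct_scoreScatter_affine μ hS hν hT hTS s, hv]
  have hq := memLp_quadForm_mul_inv ha (stdDirection S T ν (unvech s))
  have h := covariance_affine_affine hq hq (memLp_inv_one_add ha) (memLp_inv_one_add ha)
    (-(1 / 2 * (S⁻¹ * unvech s).trace)) ((ν + k) / 2) 0 (ν / 2) (-((ν + k) / 2)) 0
  simp only [zero_mul, add_zero, mul_zero] at h
  rw [h, covariance_quadForm_inv ha, trace_stdDirection hS hν hTS]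
  have : 0 < ν + k := by positivity
  field_simp
  ring

theorem Gamma33_eq (hS : S.PosDef) (hν : 0 < ν) :
    Gamma33 μ S ν = 1 / 4 * (logBracketIntegral k 2 ((ν + k) / 2) /
        logBracketIntegral k 0 ((ν + k) / 2) - (logBracketIntegral k 1 ((ν + k) / 2) /
        logBracketIntegral k 0 ((ν + k) / 2)) ^ 2) - k / (ν * (ν + k)) +
        k / (2 * ν * (ν + k + 2)) := by
  obtain ⟨T, hT, hTS⟩ := exists_mul_transpose_eq (hS.smul hν)
  have ha : (k : ℝ) / 2 < (ν + k) / 2 := by linarith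
  have := isProbabilityMeasure_stdLaw ha
  rw [Gamma33, covariance_law_eq μ hS hν hT hTS (continuous_scoreTail μ hS hν)
    (continuous_scoreTail μ hS hν)]
  simp_rw [scoreTail_affine μ hS hν hT hTS]
  rw [covariance_affine_affine (memLp_log_one_add ha) (memLp_inv_one_add ha)
    (memLp_log_one_add ha) (memLp_inv_one_add ha), covariance_log_log ha,
    covariance_comm (fun y : Fin k → ℝ => Real.log (1 + y ⬝ᵥ y)) (fun y => (1 + y ⬝ᵥ y)⁻¹),
    covariance_inv_log ha, covariance_inv_inv ha]
  have : 0 < ν + k := by positivity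
  field_simp
  ring

theorem density_pos (hS : S.PosDef) (hν : 0 < ν) (x : Fin k → ℝ) : 0 < density μ S ν x := by
  have hJ := logBracketIntegral_zero_pos (k := k) (a := (ν + k) / 2) (by linarith)
  have hd := mahalanobisSq_nonneg μ hS x
  have hdet := hS.det_pos
  rw [density, normConst_eq hν]
  positivity

/-- Needed to upgrade almost sure equality of continuous functions to equality everywhere. -/
theorem isOpenPosMeasure_law (hS : S.PosDef) (hν : 0 < ν) : (law μ S ν).IsOpenPosMeasure := by
  refine Measure.AbsolutelyContinuous.isOpenPosMeasure (μ := volume)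
    (withDensity_absolutelyContinuous' (measurable_density μ S ν).ennreal_ofReal.aemeasurable
      (Eventually.of_forall fun y => ?_))
  simpa using density_pos μ hS hν y

/-- Polarization on pairs of basis vectors. -/
theorem eq_zero_of_quadForm_eq_zero {E : Matrix (Fin k) (Fin k) ℝ} (hE : E.IsSymm)
    (h : ∀ w : Fin k → ℝ, w ⬝ᵥ (E *ᵥ w) = 0) : E = 0 := by
  ext i j
  have h1 := h (Pi.single i 1 + Pi.single j 1)
  have h2 := h (Pi.single i 1)
  have h3 := h (Pi.single j 1)
  have h4 := hE.apply i j
  simp only [Matrix.mulVec_add, dotProduct_add, add_dotProduct, single_one_dotProduct,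
    Matrix.mulVec_single_one, Matrix.col_apply] at h1 h2 h3
  simp only [Matrix.zero_apply]
  linarith

/-- The scatter information is non-singular. -/
theorem isUnit_det_Gamma22 (hS : S.PosDef) (hν : 0 < ν) : IsUnit (Gamma22 μ S ν).det := by
  have hprob := isProbabilityMeasure_law μ hS hν
  have hopen := isOpenPosMeasure_law μ hS hν
  have hu : IsUnit S.det := isUnit_iff_ne_zero.2 hS.det_pos.ne'
  rw [isUnit_iff_ne_zero]
  intro hdet
  obtain ⟨s, hs0, hs⟩ := Matrix.exists_mulVec_eq_zero_iff.2 hdet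
  refine hs0 ?_
  -- A kernel vector `s` gives a directional score of zero variance, hence almost surely constant,
  -- hence constant everywhere by continuity.
  have hcont := continuous_scoreScatter_dotProduct μ hS hν s
  have hmem := memLp_scoreScatter μ hS hν s
  have hvar : Var[fun x => s ⬝ᵥ scoreScatter μ S ν x; law μ S ν] = 0 := by
    rw [← covariance_self hcont.aemeasurable, ← Gamma22_mulVec μ hS hν, hs, dotProduct_zero]
  have hev : evariance (fun x => s ⬝ᵥ scoreScatter μ S ν x) (law μ S ν) = 0 := by
    rw [← hmem.ofReal_variance_eq, hvar, ENNReal.ofReal_zero]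
  rw [evariance_eq_zero_iff hcont.aemeasurable] at hev
  have hconst := hcont.ae_eq_iff_eq (law μ S ν) continuous_const |>.1 hev
  have hE : unvech s = 0 := by
    refine eq_zero_of_quadForm_eq_zero (unvech_isSymm s) fun w => ?_
    -- At this point `S⁻¹ (x - μ)` is the arbitrary vector `w`; at `μ` the quadratic form vanishes,
    -- which identifies the constant.
    have h1 := congrFun hconst (μ + S *ᵥ w)
    have h2 := congrFun hconst μ
    rw [← h2, dotProduct_scoreScatter μ hS hν, dotProduct_scoreScatter μ hS hν,
      add_sub_cancel_left, Matrix.mulVec_mulVec, Matrix.nonsing_inv_mul _ hu, Matrix.one_mulVec,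
      sub_self, Matrix.mulVec_zero, zero_dotProduct, mul_zero] at h1
    have h3 : (ν + k) / (ν + mahalanobisSq μ S (μ + S *ᵥ w)) * (w ⬝ᵥ (unvech s *ᵥ w)) = 0 := by
      linarith
    have hd := mahalanobisSq_nonneg μ hS (μ + S *ᵥ w)
    have h4 : (ν + k) / (ν + mahalanobisSq μ S (μ + S *ᵥ w)) ≠ 0 := by positivity
    exact (mul_eq_zero.1 h3).resolve_left h4
  rw [← vech_unvech s, hE]
  rfl

theorem Gamma22_transpose : (Gamma22 μ S ν)ᵀ = Gamma22 μ S ν := by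
  ext p q
  simp only [Matrix.transpose_apply, Gamma22, Matrix.of_apply]
  exact covariance_comm _ _

/-- Tested on a basis direction `E`, both sides are multiples of `tr (S⁻¹ E)`. The factor is the
ratio of `-1 / ((ν + k) (ν + k + 2))` to `ν / (2 (ν + k + 2))`. -/
theorem Gamma22_mulVec_vech (hS : S.PosDef) (hν : 0 < ν) :
    Gamma22 μ S ν *ᵥ ((-(2 / (ν * (ν + k)))) • vech S) = Gamma23 μ S ν := by
  ext p
  have h1 := Gamma22_mulVec μ hS hν (Pi.single p 1) (vech S)
  have h2 := dotProduct_Gamma23 μ hS hν (Pi.single p 1)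
  rw [covariance_scoreScatter_vech μ hS hν, single_one_dotProduct] at h1
  rw [covariance_scoreScatter_scoreTail μ hS hν, single_one_dotProduct] at h2
  rw [Matrix.mulVec_smul, Pi.smul_apply, h1, h2, smul_eq_mul]
  have : 0 < ν + k := by positivity
  field_simp

theorem Gamma22_inv_mulVec_Gamma23 (hS : S.PosDef) (hν : 0 < ν) :
    (Gamma22 μ S ν)⁻¹ *ᵥ Gamma23 μ S ν = (-(2 / (ν * (ν + k)))) • vech S := by
  rw [← Gamma22_mulVec_vech μ hS hν, Matrix.mulVec_mulVec,
    Matrix.nonsing_inv_mul _ (isUnit_det_Gamma22 μ hS hν), Matrix.one_mulVec]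

theorem Gamma23_dotProduct_inv_mulVec (hS : S.PosDef) (hν : 0 < ν) (r : VechIdx k → ℝ) :
    Gamma23 μ S ν ⬝ᵥ ((Gamma22 μ S ν)⁻¹ *ᵥ r) = -(2 / (ν * (ν + k))) * (vech S ⬝ᵥ r) := by
  rw [Matrix.dotProduct_mulVec, ← Matrix.mulVec_transpose, Matrix.transpose_nonsing_inv,
    Gamma22_transpose, Gamma22_inv_mulVec_Gamma23 μ hS hν, smul_dotProduct, smul_eq_mul]

theorem Gamma33Star_eq (hS : S.PosDef) (hν : 0 < ν) :
    Gamma33Star μ S ν = 1 / 4 * (logBracketIntegral k 2 ((ν + k) / 2) /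
        logBracketIntegral k 0 ((ν + k) / 2) - (logBracketIntegral k 1 ((ν + k) / 2) /
        logBracketIntegral k 0 ((ν + k) / 2)) ^ 2) -
        k * (ν + k + 2) / (2 * ν * (ν + k) ^ 2) := by
  have hu : IsUnit S.det := isUnit_iff_ne_zero.2 hS.det_pos.ne'
  rw [Gamma33Star, Gamma33_eq μ hS hν, Gamma23_dotProduct_inv_mulVec μ hS hν,
    dotProduct_Gamma23 μ hS hν, covariance_scoreScatter_scoreTail μ hS hν,
    unvech_vech (posDef_isSymm hS), Matrix.nonsing_inv_mul _ hu, Matrix.trace_one,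
    Fintype.card_fin]
  have : 0 < ν + k := by positivity
  field_simp
  ring

/-- The part of the efficient score that only depends on `ν`. -/
noncomputable def effConst (k : ℕ) (ν : ℝ) : ℝ :=
  logNormConstDeriv k ν + 1 / 2 * Real.log ν + (ν + k + 2) / (2 * ν) - k / (ν * (ν + k))

/-- The efficient score for tail weight, as a function of `A = ν + d`, where `d` is the squared
Mahalanobis distance. -/
noncomputable def effScore (k : ℕ) (ν A : ℝ) : ℝ :=
  effConst k ν - 1 / 2 * Real.log A - (ν + k + 2) / 2 / A

/-- The tail score and the scale score are both radial. Writing `d / (ν + d) = 1 - ν / A` merges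
their rational parts into a single multiple of `1 / A`. -/
theorem effScore_eq (hS : S.PosDef) (hν : 0 < ν) (x : Fin k → ℝ) :
    scoreTail μ S ν x + 2 / (ν * (ν + k)) * (vech S ⬝ᵥ scoreScatter μ S ν x) =
      effScore k ν (ν + mahalanobisSq μ S x) := by
  have hd := mahalanobisSq_nonneg μ hS x
  rw [scoreTail_eq μ hS hν, vech_dotProduct_scoreScatter μ hS hν, effScore, effConst]
  generalize mahalanobisSq μ S x = d at *
  have h1 : 0 < ν + d := by positivity
  have h2 : 0 < ν + k := by positivity
  have h3 : Real.log (1 + d / ν) = Real.log (ν + d) - Real.log ν := by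
    rw [← Real.log_div h1.ne' hν.ne']
    congr 1
    field_simp
  rw [h3]
  field_simp
  ring

theorem Delta3Star_eq (hS : S.PosDef) (hν : 0 < ν) (n : ℕ) (X : Fin n → Fin k → ℝ) :
    Delta3Star n μ S ν X =
      (√(n : ℝ))⁻¹ * ∑ i, effScore k ν (ν + mahalanobisSq μ S (X i)) := by
  rw [Delta3Star, Gamma23_dotProduct_inv_mulVec μ hS hν, Delta2, Delta3, dotProduct_smul,
    dotProduct_sum, smul_eq_mul]
  simp_rw [← effScore_eq μ hS hν]
  rw [Finset.sum_add_distrib, ← Finset.mul_sum]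
  ring

end Information

/-! ### Local perturbations of the efficient score -/

/-- The derivative of `effConst`. -/
noncomputable def effConstDeriv (k : ℕ) (ν : ℝ) : ℝ :=
  -(1 / 4 * (logBracketIntegral k 2 ((ν + k) / 2) / logBracketIntegral k 0 ((ν + k) / 2) -
    (logBracketIntegral k 1 ((ν + k) / 2) / logBracketIntegral k 0 ((ν + k) / 2)) ^ 2)) +
    1 / (2 * ν) - 1 / ν ^ 2 + k * (2 * ν + k) / (ν * (ν + k)) ^ 2

theorem hasDerivAt_effConst {k : ℕ} {ν : ℝ} (hν : 0 < ν) :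
    HasDerivAt (effConst k) (effConstDeriv k ν) ν := by
  have hJ := logBracketIntegral_zero_pos (k := k) (a := (ν + k) / 2) (by linarith)
  have hνk : 0 < ν + k := by positivity
  have h0 := hasDerivAt_logBracketIntegral_half_add (k := k) 0 hν
  have h1 := hasDerivAt_logBracketIntegral_half_add (k := k) 1 hν
  have hid := hasDerivAt_id ν
  have hc := hasDerivAt_const ν (k : ℝ)
  have hA := ((h1.div (h0.const_mul 2) (by positivity)).sub
    (hc.div (hid.const_mul 2) (by simpa using hν.ne')))
  have hB := (Real.hasDerivAt_log hν.ne').const_mul (1 / 2)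
  have hC := ((hid.add_const (k : ℝ)).add_const 2).div (hid.const_mul 2) (by simpa using hν.ne')
  have hD := hc.div (hid.mul (hid.add_const (k : ℝ)))
    (by simpa using ⟨hν.ne', hνk.ne'⟩)
  refine ((((hA.add hB).add hC).sub hD).congr_deriv ?_)
  simp only [effConstDeriv, id, zero_add, one_add_one_eq_two, Pi.mul_apply]
  field_simp
  ring

/-- The local parameter space: location, precision matrix, tail weight. -/
abbrev LocalParam (k : ℕ) : Type := (Fin k → ℝ) × (Fin k → Fin k → ℝ) × ℝ

/-- The base point of the local parameter space. -/
def baseParam (k : ℕ) (ν : ℝ) : LocalParam k := (0, fun i j => if i = j then ν else 0, ν)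

/-- The quantity `ν + d` in standardized coordinates. -/
def localDist {k : ℕ} (θ : LocalParam k) (y : Fin k → ℝ) : ℝ :=
  θ.2.2 + (y - θ.1) ⬝ᵥ (Matrix.of θ.2.1 *ᵥ (y - θ.1))

theorem of_baseParam (k : ℕ) (ν : ℝ) :
    Matrix.of (baseParam k ν).2.1 = ν • (1 : Matrix (Fin k) (Fin k) ℝ) := by
  ext i j
  simp [baseParam, Matrix.one_apply]

theorem localDist_base {k : ℕ} (ν : ℝ) (y : Fin k → ℝ) :
    localDist (baseParam k ν) y = ν * (1 + y ⬝ᵥ y) := by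
  rw [localDist, of_baseParam, Matrix.smul_mulVec, Matrix.one_mulVec, dotProduct_smul]
  simp [baseParam]
  ring

theorem localDist_eq_sum {k : ℕ} (θ : LocalParam k) (y : Fin k → ℝ) :
    localDist θ y = θ.2.2 + ∑ i, ∑ j, (y i - θ.1 i) * (θ.2.1 i j * (y j - θ.1 j)) := by
  simp [localDist, dotProduct, Matrix.mulVec, Finset.mul_sum]

theorem abs_coord_le {k : ℕ} (y : Fin k → ℝ) (i : Fin k) : |y i| ≤ 1 + y ⬝ᵥ y := by
  have h := abs_mul_coord_le y i i
  rw [abs_mul_self] at h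
  rw [abs_le]
  constructor <;> nlinarith

/-- The bound grows no faster than `localDist` at the base point, which equals `ν (1 + ‖y‖²)`, so
the relative perturbation is uniform in `y`. Parametrizing by the precision matrix makes the
distance polynomial in the parameter. -/
theorem abs_localDist_sub_le {k : ℕ} {ν : ℝ} (hν : 0 < ν) {θ : LocalParam k}
    (hθ : ‖θ - baseParam k ν‖ ≤ 1) (y : Fin k → ℝ) :
    |localDist θ y - localDist (baseParam k ν) y| ≤
      ((k : ℝ) ^ 2 * (4 + 3 * ν) + 1) * ‖θ - baseParam k ν‖ * (1 + y ⬝ᵥ y) := by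
  set ε := ‖θ - baseParam k ν‖ with hε
  have hε0 : 0 ≤ ε := norm_nonneg _
  have hr := one_le_one_add_dotProduct_self y
  set r := 1 + y ⬝ᵥ y with hr_def
  have hm : ∀ i, |θ.1 i| ≤ ε := by
    intro i
    have h1 : ‖(θ - baseParam k ν).1‖ ≤ ε := norm_fst_le _
    have h2 := (norm_le_pi_norm (θ - baseParam k ν).1 i).trans h1
    simpa [baseParam] using h2
  have hQ : ∀ i j, |θ.2.1 i j - (baseParam k ν).2.1 i j| ≤ ε := by
    intro i j
    have h1 : ‖(θ - baseParam k ν).2.1‖ ≤ ε := (norm_fst_le _).trans (norm_snd_le _)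
    exact (norm_le_pi_norm _ j).trans ((norm_le_pi_norm (θ - baseParam k ν).2.1 i).trans h1)
  have hv : |θ.2.2 - ν| ≤ ε := by
    have h1 : ‖(θ - baseParam k ν).2.2‖ ≤ ε := (norm_snd_le _).trans (norm_snd_le _)
    simpa [baseParam] using h1
  have hQ0 : ∀ i j, |(baseParam k ν).2.1 i j| ≤ ν := by
    intro i j
    simp only [baseParam]
    split_ifs
    · rw [abs_of_pos hν]
    · simpa using hν.le
  have hterm : ∀ i j, |(y i - θ.1 i) * (θ.2.1 i j * (y j - θ.1 j)) -
      y i * ((baseParam k ν).2.1 i j * y j)| ≤ (4 + 3 * ν) * ε * r := by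
    intro i j
    -- The precision error multiplies four products of size at most `r`, giving `4 ε r`. The base
    -- precision, at most `ν`, multiplies three products of size at most `ε r`, giving `3 ν ε r`.
    have e : (y i - θ.1 i) * (θ.2.1 i j * (y j - θ.1 j)) -
        y i * ((baseParam k ν).2.1 i j * y j) =
        (θ.2.1 i j - (baseParam k ν).2.1 i j) *
          (y i * y j - θ.1 i * y j - y i * θ.1 j + θ.1 i * θ.1 j) +
        (baseParam k ν).2.1 i j * (θ.1 i * θ.1 j - θ.1 i * y j - y i * θ.1 j) := by ring
    have p1 : |y i * y j| ≤ r := (abs_mul_coord_le y i j).trans (by linarith)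
    have p2 : |θ.1 i * y j| ≤ ε * r := by
      rw [abs_mul]
      exact mul_le_mul (hm i) (abs_coord_le y j) (abs_nonneg _) hε0
    have p3 : |y i * θ.1 j| ≤ ε * r := by
      rw [abs_mul, mul_comm]
      exact mul_le_mul (hm j) (abs_coord_le y i) (abs_nonneg _) hε0
    have p4 : |θ.1 i * θ.1 j| ≤ ε * r := by
      rw [abs_mul]
      exact mul_le_mul (hm i) ((hm j).trans (hθ.trans hr)) (abs_nonneg _) hε0
    have p5 : ε * r ≤ r := by nlinarith
    have q1 : |y i * y j - θ.1 i * y j - y i * θ.1 j + θ.1 i * θ.1 j| ≤ 4 * r := by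
      rw [abs_le] at *
      constructor <;> linarith [p1.1, p1.2, p2.1, p2.2, p3.1, p3.2, p4.1, p4.2]
    have q2 : |θ.1 i * θ.1 j - θ.1 i * y j - y i * θ.1 j| ≤ 3 * (ε * r) := by
      rw [abs_le] at *
      constructor <;> linarith [p2.1, p2.2, p3.1, p3.2, p4.1, p4.2]
    rw [e]
    refine (abs_add_le _ _).trans ?_
    rw [abs_mul, abs_mul]
    have s1 := mul_le_mul (hQ i j) q1 (abs_nonneg _) hε0
    have s2 := mul_le_mul (hQ0 i j) q2 (abs_nonneg _) hν.le
    linarith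
  rw [localDist_eq_sum, localDist_eq_sum]
  have e2 : (θ.2.2 + ∑ i, ∑ j, (y i - θ.1 i) * (θ.2.1 i j * (y j - θ.1 j))) -
      ((baseParam k ν).2.2 + ∑ i, ∑ j, (y i - (baseParam k ν).1 i) *
        ((baseParam k ν).2.1 i j * (y j - (baseParam k ν).1 j))) =
      (θ.2.2 - ν) + ∑ i, ∑ j, ((y i - θ.1 i) * (θ.2.1 i j * (y j - θ.1 j)) -
        y i * ((baseParam k ν).2.1 i j * y j)) := by
    simp only [Finset.sum_sub_distrib]
    simp only [baseParam, Pi.zero_apply, sub_zero]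
    ring
  rw [e2]
  have e3 : |∑ i, ∑ j, ((y i - θ.1 i) * (θ.2.1 i j * (y j - θ.1 j)) -
        y i * ((baseParam k ν).2.1 i j * y j))| ≤ ∑ _i : Fin k, ∑ _j : Fin k,
          (4 + 3 * ν) * ε * r :=
    (Finset.abs_sum_le_sum_abs _ _).trans (Finset.sum_le_sum fun i _ =>
      (Finset.abs_sum_le_sum_abs _ _).trans (Finset.sum_le_sum fun j _ => hterm i j))
  simp only [Finset.sum_const, Finset.card_univ, Fintype.card_fin, nsmul_eq_mul] at e3
  refine (abs_add_le _ _).trans ?_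
  have e4 : ε ≤ ε * r := by nlinarith
  linarith

/-- The efficient score is Lipschitz at the base point, uniformly in the observation. -/
theorem exists_abs_effScore_sub_le (k : ℕ) {ν : ℝ} (hν : 0 < ν) :
    ∃ K : ℝ, ∃ s ∈ 𝓝 (baseParam k ν), ∀ θ ∈ s, ∀ y : Fin k → ℝ,
      |effScore k θ.2.2 (localDist θ y) - effScore k ν (localDist (baseParam k ν) y)| ≤
        K * ‖θ - baseParam k ν‖ := by
  obtain ⟨C, hC⟩ := (hasDerivAt_effConst (k := k) hν).isBigO_sub.bound
  set K₁ : ℝ := (k : ℝ) ^ 2 * (4 + 3 * ν) + 1 with hK₁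
  have hK₁0 : 0 < K₁ := by positivity
  set c := K₁ / ν with hc
  have hc0 : 0 < c := by positivity
  set κ : ℝ := (ν + k + 2) / 2 with hκ
  have hκ0 : 0 < κ := by positivity
  refine ⟨|C| + c + (1 / ν + 2 * κ * c / ν),
    {θ | ‖θ - baseParam k ν‖ ≤ 1 ∧ c * ‖θ - baseParam k ν‖ ≤ 1 / 2 ∧
      ‖effConst k θ.2.2 - effConst k ν‖ ≤ C * ‖θ.2.2 - ν‖}, ?_, ?_⟩
  · have t1 : Tendsto (fun θ : LocalParam k => ‖θ - baseParam k ν‖) (𝓝 (baseParam k ν)) (𝓝 0) := by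
      have : Continuous fun θ : LocalParam k => ‖θ - baseParam k ν‖ := by fun_prop
      simpa using this.tendsto (baseParam k ν)
    have t2 : Tendsto (fun θ : LocalParam k => θ.2.2) (𝓝 (baseParam k ν)) (𝓝 ν) :=
      (continuous_snd.comp continuous_snd).tendsto (baseParam k ν)
    have t3 : Tendsto (fun θ : LocalParam k => c * ‖θ - baseParam k ν‖) (𝓝 (baseParam k ν))
        (𝓝 0) := by simpa using t1.const_mul c
    filter_upwards [t1.eventually (ge_mem_nhds one_pos),
      t3.eventually (ge_mem_nhds (half_pos one_pos)), t2.eventually hC] with θ h1 h2 h3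
    exact ⟨h1, h2, h3⟩
  · rintro θ ⟨h1, h2, h3⟩ y
    have hd := abs_localDist_sub_le hν h1 y
    have hv : |θ.2.2 - ν| ≤ ‖θ - baseParam k ν‖ := by
      have h1 : ‖(θ - baseParam k ν).2.2‖ ≤ ‖θ - baseParam k ν‖ :=
        (norm_snd_le _).trans (norm_snd_le _)
      simpa [baseParam] using h1
    rw [localDist_base] at hd ⊢
    rw [Real.norm_eq_abs, Real.norm_eq_abs] at h3
    set ε := ‖θ - baseParam k ν‖ with hε
    have hε0 : 0 ≤ ε := norm_nonneg _
    have hr := one_le_one_add_dotProduct_self y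
    set r := 1 + y ⬝ᵥ y
    set A := ν * r with hA
    set A₁ := localDist θ y
    set v := θ.2.2
    have hAν : ν ≤ A := by nlinarith
    have hA0 : 0 < A := hν.trans_le hAν
    have hd' : |A₁ - A| ≤ c * ε * A := by
      refine hd.trans_eq ?_
      rw [hc, hA, hK₁]
      field_simp
    have hA₁A : A / 2 ≤ A₁ := by
      have := (abs_le.1 hd').1
      nlinarith
    have hA₁pos : 0 < A₁ := by linarith
    have hA₁ν : ν / 2 ≤ A₁ := by linarith
    have b1 : |effConst k v - effConst k ν| ≤ |C| * ε :=
      h3.trans (mul_le_mul (le_abs_self _) hv (abs_nonneg _) (abs_nonneg _))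
    have hcA : |A₁ - A| / A₁ ≤ 2 * (c * ε) := by
      rw [div_le_iff₀ hA₁pos]
      refine hd'.trans ?_
      have : 0 ≤ c * ε := by positivity
      nlinarith
    -- Both directions come from `log t ≤ t - 1`, applied to `A / A₁` and to `A₁ / A`.
    have b2 : |Real.log A₁ - Real.log A| ≤ 2 * (c * ε) := by
      rw [abs_le]
      constructor
      · have h := Real.log_le_sub_one_of_pos (div_pos hA0 hA₁pos)
        rw [Real.log_div hA0.ne' hA₁pos.ne'] at h
        have h' : A / A₁ - 1 ≤ |A₁ - A| / A₁ := by
          rw [div_sub_one hA₁pos.ne', abs_sub_comm]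
          gcongr
          exact le_abs_self _
        linarith
      · have h := Real.log_le_sub_one_of_pos (div_pos hA₁pos hA0)
        rw [Real.log_div hA₁pos.ne' hA0.ne', div_sub_one hA0.ne'] at h
        have h' : (A₁ - A) / A ≤ c * ε := by
          rw [div_le_iff₀ hA0]
          exact (le_abs_self _).trans hd'
        have : 0 ≤ c * ε := by positivity
        linarith
    have b3 : |(v + k + 2) / 2 / A₁ - κ / A| ≤ (1 / ν + 2 * κ * c / ν) * ε := by
      have e : (v + k + 2) / 2 / A₁ - κ / A =
          (v - ν) / 2 / A₁ + κ / A * (-((A₁ - A) / A₁)) := by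
        rw [hκ]
        field_simp
        ring
      rw [e]
      refine (abs_add_le _ _).trans ?_
      have q1 : |(v - ν) / 2 / A₁| ≤ 1 / ν * ε := by
        rw [abs_div, abs_of_pos hA₁pos, abs_div, abs_two, div_le_iff₀ hA₁pos]
        have : ε / 2 = 1 / ν * ε * (ν / 2) := by field_simp
        have h5 : 1 / ν * ε * (ν / 2) ≤ 1 / ν * ε * A₁ := by gcongr
        linarith
      have q2 : |κ / A * (-((A₁ - A) / A₁))| ≤ κ / ν * (2 * (c * ε)) := by
        rw [abs_mul, abs_neg, abs_div (A₁ - A), abs_of_pos hA₁pos, abs_of_pos (div_pos hκ0 hA0)]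
        gcongr
      have : (1 / ν + 2 * κ * c / ν) * ε = 1 / ν * ε + κ / ν * (2 * (c * ε)) := by ring
      linarith
    rw [effScore, effScore]
    have e : effConst k v - 1 / 2 * Real.log A₁ - (v + k + 2) / 2 / A₁ -
        (effConst k ν - 1 / 2 * Real.log A - (ν + k + 2) / 2 / A) =
        (effConst k v - effConst k ν) - 1 / 2 * (Real.log A₁ - Real.log A) -
          ((v + k + 2) / 2 / A₁ - κ / A) := by
      rw [hκ]
      ring
    rw [e, abs_le]
    rw [abs_le] at b1 b2 b3
    constructor <;> nlinarith [b1.1, b1.2, b2.1, b2.2, b3.1, b3.2]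

theorem differentiable_localDist {k : ℕ} (y : Fin k → ℝ) :
    Differentiable ℝ fun θ : LocalParam k => localDist θ y := by
  simp_rw [localDist_eq_sum]
  fun_prop

theorem localDist_base_pos {k : ℕ} {ν : ℝ} (hν : 0 < ν) (y : Fin k → ℝ) :
    0 < localDist (baseParam k ν) y := by
  rw [localDist_base]
  exact mul_pos hν (one_add_dotProduct_self_pos y)

theorem differentiableAt_effScore {k : ℕ} {ν : ℝ} (hν : 0 < ν) (y : Fin k → ℝ) :
    DifferentiableAt ℝ (fun θ : LocalParam k => effScore k θ.2.2 (localDist θ y))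
      (baseParam k ν) := by
  have h1 : DifferentiableAt ℝ (fun θ : LocalParam k => effConst k θ.2.2) (baseParam k ν) :=
    DifferentiableAt.comp (g := effConst k) (baseParam k ν)
      (hasDerivAt_effConst hν).differentiableAt (by fun_prop)
  have h2 := (differentiable_localDist y) (baseParam k ν)
  have h3 := (localDist_base_pos hν y).ne'
  have h4 : DifferentiableAt ℝ (fun θ : LocalParam k => (θ.2.2 + k + 2) / 2)
      (baseParam k ν) := by fun_prop
  have h5 := h4.fun_mul ((differentiableAt_inv h3).comp (baseParam k ν) h2)
  simp only [effScore]
  exact (h1.sub ((h2.log h3).const_mul _)).sub h5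

/-- Along a line the distance is a cubic polynomial in the step; its linear coefficient is the
derivative. -/
theorem hasDerivAt_localDist_line {k : ℕ} (ν : ℝ) (y : Fin k → ℝ) (v : LocalParam k) :
    HasDerivAt (fun t : ℝ => localDist (baseParam k ν + t • v) y)
      (v.2.2 + y ⬝ᵥ (Matrix.of v.2.1 *ᵥ y) - 2 * ν * (v.1 ⬝ᵥ y)) 0 := by
  set B : Matrix (Fin k) (Fin k) ℝ := Matrix.of v.2.1 with hB
  have hexp : ∀ t : ℝ, localDist (baseParam k ν + t • v) y =
      ν * (1 + y ⬝ᵥ y) + (v.2.2 + y ⬝ᵥ (B *ᵥ y) - 2 * ν * (v.1 ⬝ᵥ y)) * t +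
      (ν * (v.1 ⬝ᵥ v.1) - y ⬝ᵥ (B *ᵥ v.1) - v.1 ⬝ᵥ (B *ᵥ y) + t * (v.1 ⬝ᵥ (B *ᵥ v.1))) *
        t ^ 2 := by
    intro t
    have h1 : Matrix.of (baseParam k ν + t • v).2.1 = ν • 1 + t • B := by
      rw [← of_baseParam]
      rfl
    have h2 : (baseParam k ν + t • v).1 = t • v.1 := by simp [baseParam]
    have h3 : (baseParam k ν + t • v).2.2 = ν + t * v.2.2 := by simp [baseParam]
    rw [localDist, h1, h2, h3]
    simp only [Matrix.add_mulVec, Matrix.smul_mulVec, Matrix.one_mulVec, Matrix.mulVec_sub,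
      Matrix.mulVec_smul, sub_dotProduct, dotProduct_sub, dotProduct_add, smul_dotProduct,
      dotProduct_smul, smul_eq_mul, dotProduct_comm y v.1]
    ring
  simp_rw [hexp]
  have hid := hasDerivAt_id (0 : ℝ)
  refine (((hid.const_mul (v.2.2 + y ⬝ᵥ (B *ᵥ y) - 2 * ν * (v.1 ⬝ᵥ y))).const_add
    (ν * (1 + y ⬝ᵥ y))).add (((hid.mul_const (v.1 ⬝ᵥ (B *ᵥ v.1))).const_add
      (ν * (v.1 ⬝ᵥ v.1) - y ⬝ᵥ (B *ᵥ v.1) - v.1 ⬝ᵥ (B *ᵥ y))).mul (hid.pow 2))).congr_deriv ?_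
  simp

/-- The weight of the derivative of the squared distance in the derivative of the score. -/
noncomputable def radialWeight (k : ℕ) (ν r : ℝ) : ℝ :=
  -(1 / (2 * ν)) * (1 + r)⁻¹ + (ν + k + 2) / (2 * ν ^ 2) * (1 + r)⁻¹ ^ 2

theorem fderiv_effScore_apply {k : ℕ} {ν : ℝ} (hν : 0 < ν) (y : Fin k → ℝ) (v : LocalParam k) :
    fderiv ℝ (fun θ : LocalParam k => effScore k θ.2.2 (localDist θ y)) (baseParam k ν) v =
      v.2.2 * (effConstDeriv k ν - 1 / ν * (1 + y ⬝ᵥ y)⁻¹ +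
        (ν + k + 2) / (2 * ν ^ 2) * (1 + y ⬝ᵥ y)⁻¹ ^ 2) +
      ((y ⬝ᵥ (Matrix.of v.2.1 *ᵥ y)) * radialWeight k ν (y ⬝ᵥ y) +
        -(2 * ν) * ((v.1 ⬝ᵥ y) * radialWeight k ν (y ⬝ᵥ y))) := by
  have hb := one_add_dotProduct_self_pos y
  have hline : HasDerivAt (fun t : ℝ => baseParam k ν + t • v) v 0 := by
    simpa using ((hasDerivAt_id (0 : ℝ)).smul_const v).const_add (baseParam k ν)
  have h0 : baseParam k ν + (0 : ℝ) • v = baseParam k ν := by simp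
  have hF := (differentiableAt_effScore hν y).hasFDerivAt
  -- Differentiability is already known, so the Fréchet derivative is identified by its value along
  -- each line through the base point.
  rw [← h0] at hF
  have h1 := hF.comp_hasDerivAt (0 : ℝ) hline
  rw [h0] at h1
  have hv : HasDerivAt (fun t : ℝ => (baseParam k ν + t • v).2.2) v.2.2 0 := by
    have := ((hasDerivAt_id (0 : ℝ)).mul_const v.2.2).const_add ν
    simpa [baseParam] using this
  have hv0 : (baseParam k ν + (0 : ℝ) • v).2.2 = ν := by simp [baseParam]
  have hd := hasDerivAt_localDist_line ν y v
  have hd0 : localDist (baseParam k ν + (0 : ℝ) • v) y = ν * (1 + y ⬝ᵥ y) := by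
    rw [h0, localDist_base]
  have hd1 : localDist (baseParam k ν + (0 : ℝ) • v) y ≠ 0 := by
    rw [hd0]
    positivity
  have hG : HasDerivAt (fun t : ℝ => effConst k (baseParam k ν + t • v).2.2)
      (effConstDeriv k ν * v.2.2) 0 :=
    HasDerivAt.comp (h₂ := effConst k) (0 : ℝ) (by rw [hv0]; exact hasDerivAt_effConst hν) hv
  have h2 := (hG.sub ((hd.log hd1).const_mul (1 / 2))).sub
    ((((hv.add_const (k : ℝ)).add_const 2).div_const 2).div hd hd1)
  have h3 := h1.unique h2
  rw [h3, hd0, hv0, radialWeight]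
  field_simp
  ring

theorem continuous_radialWeight (k : ℕ) (ν : ℝ) :
    Continuous fun y : Fin k → ℝ => radialWeight k ν (y ⬝ᵥ y) := by
  unfold radialWeight
  exact (continuous_const.mul continuous_inv_one_add).add
    (continuous_const.mul (continuous_inv_one_add.pow 2))

theorem continuous_fderiv_effScore {k : ℕ} {ν : ℝ} (hν : 0 < ν) :
    Continuous fun y : Fin k → ℝ =>
      fderiv ℝ (fun θ : LocalParam k => effScore k θ.2.2 (localDist θ y)) (baseParam k ν) := by
  rw [continuous_clm_apply]
  intro v
  simp_rw [fderiv_effScore_apply hν]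
  have hw := continuous_radialWeight k ν
  have hi := continuous_inv_one_add (k := k)
  have hl : Continuous fun y : Fin k → ℝ => v.1 ⬝ᵥ y := by
    unfold dotProduct
    fun_prop
  exact (continuous_const.mul ((continuous_const.sub (continuous_const.mul hi)).add
    (continuous_const.mul (hi.pow 2)))).add (((continuous_quadForm _).mul hw).add
      (continuous_const.mul (hl.mul hw)))

/-! ### The mean of the efficient score to first order -/

/-- The vanishing integral expresses the orthogonality of the efficient score to scale changes.
After `‖y‖² (1 + ‖y‖²)⁻¹ = 1 - (1 + ‖y‖²)⁻¹` it is an identity between the first two moments of the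
inverse bracket, and it depends on the coefficient `ν + k + 2`. -/
theorem integral_dotProduct_self_mul_radialWeight {k : ℕ} {ν : ℝ} (hν : 0 < ν) :
    Integrable (fun y : Fin k → ℝ => (y ⬝ᵥ y) * radialWeight k ν (y ⬝ᵥ y))
      (stdLaw k ((ν + k) / 2)) ∧
    ∫ y : Fin k → ℝ, (y ⬝ᵥ y) * radialWeight k ν (y ⬝ᵥ y) ∂(stdLaw k ((ν + k) / 2)) = 0 := by
  have ha : (k : ℝ) / 2 < (ν + k) / 2 := by linarith
  have := isProbabilityMeasure_stdLaw ha
  have hνk : 0 < ν + k := by positivity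
  have hb : Integrable (fun y : Fin k → ℝ => (1 + y ⬝ᵥ y)⁻¹) (stdLaw k ((ν + k) / 2)) :=
    (memLp_inv_one_add ha).integrable one_le_two
  have hb2 : Integrable (fun y : Fin k → ℝ => (1 + y ⬝ᵥ y)⁻¹ ^ 2) (stdLaw k ((ν + k) / 2)) :=
    (memLp_inv_one_add ha).integrable_sq
  have e : ∀ y : Fin k → ℝ, (y ⬝ᵥ y) * radialWeight k ν (y ⬝ᵥ y) =
      -(1 / (2 * ν)) + ((1 / (2 * ν) + (ν + k + 2) / (2 * ν ^ 2)) * (1 + y ⬝ᵥ y)⁻¹ +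
        -((ν + k + 2) / (2 * ν ^ 2)) * (1 + y ⬝ᵥ y)⁻¹ ^ 2) := by
    intro y
    have h := dotProduct_self_mul_inv y
    rw [radialWeight]
    linear_combination (-(1 / (2 * ν)) + (ν + k + 2) / (2 * ν ^ 2) * (1 + y ⬝ᵥ y)⁻¹) * h
  simp_rw [e]
  have hsum : Integrable (fun y : Fin k → ℝ =>
      (1 / (2 * ν) + (ν + k + 2) / (2 * ν ^ 2)) * (1 + y ⬝ᵥ y)⁻¹ +
        -((ν + k + 2) / (2 * ν ^ 2)) * (1 + y ⬝ᵥ y)⁻¹ ^ 2) (stdLaw k ((ν + k) / 2)) :=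
    (hb.const_mul _).add (hb2.const_mul _)
  refine ⟨(integrable_const _).add hsum, ?_⟩
  rw [integral_add (integrable_const _) hsum, integral_add (hb.const_mul _) (hb2.const_mul _),
    integral_const_mul, integral_const_mul, integral_inv_one_add ha, integral_inv_one_add_sq ha]
  simp only [integral_const, probReal_univ, one_smul]
  field_simp
  ring

theorem measurable_radialWeight (k : ℕ) (ν : ℝ) : Measurable (radialWeight k ν) := by
  unfold radialWeight
  fun_prop

theorem integrable_dotProduct_mul_radialWeight {k : ℕ} {ν : ℝ} (hν : 0 < ν) (m : Fin k → ℝ) :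
    Integrable (fun y : Fin k → ℝ => (m ⬝ᵥ y) * radialWeight k ν (y ⬝ᵥ y))
      (stdLaw k ((ν + k) / 2)) := by
  have ha : (k : ℝ) / 2 < (ν + k) / 2 := by linarith
  have hprob := isProbabilityMeasure_stdLaw ha
  have hl : Continuous fun y : Fin k → ℝ => m ⬝ᵥ y := by
    unfold dotProduct
    fun_prop
  refine Integrable.of_bound (hl.mul (continuous_radialWeight k ν)).aestronglyMeasurable
    ((∑ i, |m i|) * (1 / (2 * ν) + (ν + k + 2) / (2 * ν ^ 2))) (Eventually.of_forall fun y => ?_)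
  have hb := one_le_one_add_dotProduct_self y
  have h1 : |m ⬝ᵥ y| ≤ (∑ i, |m i|) * (1 + y ⬝ᵥ y) := by
    rw [dotProduct, Finset.sum_mul]
    refine (Finset.abs_sum_le_sum_abs _ _).trans (Finset.sum_le_sum fun i _ => ?_)
    rw [abs_mul]
    exact mul_le_mul_of_nonneg_left (abs_coord_le y i) (abs_nonneg _)
  have h2 : |radialWeight k ν (y ⬝ᵥ y)| ≤
      (1 / (2 * ν) + (ν + k + 2) / (2 * ν ^ 2)) * (1 + y ⬝ᵥ y)⁻¹ := by
    have hi0 : 0 < (1 + y ⬝ᵥ y)⁻¹ := inv_pos.2 (one_add_dotProduct_self_pos y)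
    have hi1 : (1 + y ⬝ᵥ y)⁻¹ ≤ 1 := inv_le_one_of_one_le₀ hb
    have hc1 : 0 < 1 / (2 * ν) := by positivity
    have hc2 : 0 < (ν + k + 2) / (2 * ν ^ 2) := by positivity
    rw [radialWeight]
    generalize (1 + y ⬝ᵥ y)⁻¹ = b at *
    generalize 1 / (2 * ν) = c₁ at *
    generalize (ν + k + 2) / (2 * ν ^ 2) = c₂ at *
    have h3 : c₂ * b ^ 2 ≤ c₂ * b := by
      have : b ^ 2 ≤ b := by nlinarith
      gcongr
    have h4 : 0 < c₁ * b := by positivity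
    have h5 : 0 < c₂ * b ^ 2 := by positivity
    rw [abs_le]
    constructor <;> nlinarith
  rw [norm_mul, Real.norm_eq_abs, Real.norm_eq_abs]
  refine (mul_le_mul h1 h2 (abs_nonneg _) (by positivity)).trans_eq ?_
  have := (one_add_dotProduct_self_pos y).ne'
  field_simp

theorem integral_fderiv_effScore {k : ℕ} {ν : ℝ} (hν : 0 < ν) (v : LocalParam k) :
    ∫ y : Fin k → ℝ, fderiv ℝ (fun θ : LocalParam k => effScore k θ.2.2 (localDist θ y))
      (baseParam k ν) v ∂(stdLaw k ((ν + k) / 2)) =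
    -((1 / 4 * (logBracketIntegral k 2 ((ν + k) / 2) /
        logBracketIntegral k 0 ((ν + k) / 2) - (logBracketIntegral k 1 ((ν + k) / 2) /
        logBracketIntegral k 0 ((ν + k) / 2)) ^ 2) -
        k * (ν + k + 2) / (2 * ν * (ν + k) ^ 2)) * v.2.2) := by
  have ha : (k : ℝ) / 2 < (ν + k) / 2 := by linarith
  have hprob := isProbabilityMeasure_stdLaw ha
  have hνk : 0 < ν + k := by positivity
  have hb : Integrable (fun y : Fin k → ℝ => (1 + y ⬝ᵥ y)⁻¹) (stdLaw k ((ν + k) / 2)) :=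
    (memLp_inv_one_add ha).integrable one_le_two
  have hb2 : Integrable (fun y : Fin k → ℝ => (1 + y ⬝ᵥ y)⁻¹ ^ 2) (stdLaw k ((ν + k) / 2)) :=
    (memLp_inv_one_add ha).integrable_sq
  obtain ⟨hw, hw0⟩ := integral_dotProduct_self_mul_radialWeight (k := k) hν
  have hI1 : Integrable (fun y : Fin k → ℝ => v.2.2 * (effConstDeriv k ν -
      1 / ν * (1 + y ⬝ᵥ y)⁻¹ + (ν + k + 2) / (2 * ν ^ 2) * (1 + y ⬝ᵥ y)⁻¹ ^ 2))
      (stdLaw k ((ν + k) / 2)) :=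
    (((integrable_const _).sub (hb.const_mul _)).add (hb2.const_mul _)).const_mul _
  have hI2 : Integrable (fun y : Fin k → ℝ => (y ⬝ᵥ (Matrix.of v.2.1 *ᵥ y)) *
      radialWeight k ν (y ⬝ᵥ y)) (stdLaw k ((ν + k) / 2)) := by
    refine (hw.const_mul (∑ i, ∑ j, |Matrix.of v.2.1 i j|)).mono
      ((continuous_quadForm _).mul (continuous_radialWeight k ν)).aestronglyMeasurable
      (Eventually.of_forall fun y => ?_)
    rw [norm_mul, ← mul_assoc, norm_mul _ (radialWeight _ _ _)]
    gcongr
    rw [Real.norm_eq_abs]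
    exact (abs_quadForm_le _ y).trans (le_abs_self _)
  have hI3 := integrable_dotProduct_mul_radialWeight (k := k) hν v.1
  -- The location direction enters through an odd function of `y`.
  have hodd : ∫ y : Fin k → ℝ, (v.1 ⬝ᵥ y) * radialWeight k ν (y ⬝ᵥ y)
      ∂(stdLaw k ((ν + k) / 2)) = 0 := by
    refine integral_stdLaw_odd _ ?_ fun y => ?_
    · have hl : Continuous fun y : Fin k → ℝ => v.1 ⬝ᵥ y := by
        unfold dotProduct
        fun_prop
      exact (hl.mul (continuous_radialWeight k ν)).measurable
    · simp
  have hI4 : Integrable (fun y : Fin k → ℝ => (y ⬝ᵥ (Matrix.of v.2.1 *ᵥ y)) *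
      radialWeight k ν (y ⬝ᵥ y) + -(2 * ν) * ((v.1 ⬝ᵥ y) * radialWeight k ν (y ⬝ᵥ y)))
      (stdLaw k ((ν + k) / 2)) := hI2.add (hI3.const_mul _)
  have hI5 : Integrable (fun y : Fin k → ℝ => effConstDeriv k ν - 1 / ν * (1 + y ⬝ᵥ y)⁻¹)
      (stdLaw k ((ν + k) / 2)) := (integrable_const _).sub (hb.const_mul _)
  simp_rw [fderiv_effScore_apply hν]
  -- The precision direction averages to a trace times the vanishing integral `hw0`, so only the
  -- tail component of `v` survives.
  rw [integral_add hI1 hI4, integral_add hI2 (hI3.const_mul _),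
    integral_const_mul, integral_const_mul, hodd,
    integral_quadForm_mul_radial _ (measurable_radialWeight k ν) hw, hw0,
    integral_add hI5 (hb2.const_mul _),
    integral_sub (integrable_const _) (hb.const_mul _), integral_const_mul, integral_const_mul,
    integral_inv_one_add ha, integral_inv_one_add_sq ha]
  simp only [integral_const, probReal_univ, one_smul, mul_zero, add_zero]
  rw [effConstDeriv]
  generalize logBracketIntegral k 2 ((ν + k) / 2) / logBracketIntegral k 0 ((ν + k) / 2) -
    (logBracketIntegral k 1 ((ν + k) / 2) / logBracketIntegral k 0 ((ν + k) / 2)) ^ 2 = C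
  field_simp
  ring

theorem continuous_localDist {k : ℕ} (θ : LocalParam k) :
    Continuous fun y : Fin k → ℝ => localDist θ y := by
  simp_rw [localDist_eq_sum]
  fun_prop

theorem measurable_effScore {k : ℕ} {α : Type*} [MeasurableSpace α] (v : ℝ) {A : α → ℝ}
    (hA : Measurable A) : Measurable fun x => effScore k v (A x) := by
  unfold effScore
  exact (measurable_const.sub ((Real.measurable_log.comp hA).const_mul _)).sub
    (measurable_const.div hA)

theorem baseParam_tail (k : ℕ) (ν : ℝ) : (baseParam k ν).2.2 = ν := rfl

theorem integrable_effScore_base {k : ℕ} {ν : ℝ} (hν : 0 < ν) :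
    Integrable (fun y : Fin k → ℝ => effScore k ν (localDist (baseParam k ν) y))
      (stdLaw k ((ν + k) / 2)) := by
  have ha : (k : ℝ) / 2 < (ν + k) / 2 := by linarith
  have hprob := isProbabilityMeasure_stdLaw ha
  have e : ∀ y : Fin k → ℝ, effScore k ν (localDist (baseParam k ν) y) =
      (effConst k ν - 1 / 2 * Real.log ν) - 1 / 2 * Real.log (1 + y ⬝ᵥ y) -
        (ν + k + 2) / (2 * ν) * (1 + y ⬝ᵥ y)⁻¹ := by
    intro y
    have hb := one_add_dotProduct_self_pos y
    rw [effScore, localDist_base, Real.log_mul hν.ne' hb.ne']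
    field_simp
    ring
  simp_rw [e]
  exact ((integrable_const _).sub (((memLp_log_one_add ha).integrable one_le_two).const_mul _)).sub
    (((memLp_inv_one_add ha).integrable one_le_two).const_mul _)

/-- The mean of the efficient score at a nearby parameter, as a function of that parameter. -/
noncomputable def meanScore (k : ℕ) (ν : ℝ) (θ : LocalParam k) : ℝ :=
  ∫ y, effScore k θ.2.2 (localDist θ y) ∂(stdLaw k ((ν + k) / 2))

/-- The mean efficient score is differentiable, with a derivative which does not depend on
location and scatter. -/
theorem exists_hasFDerivAt_meanScore {k : ℕ} (μ : Fin k → ℝ) {S : Matrix (Fin k) (Fin k) ℝ} {ν : ℝ}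
    (hS : S.PosDef) (hν : 0 < ν) : ∃ D : LocalParam k →L[ℝ] ℝ,
      HasFDerivAt (meanScore k ν) D (baseParam k ν) ∧
        ∀ v, D v = -(Gamma33Star μ S ν * v.2.2) := by
  have ha : (k : ℝ) / 2 < (ν + k) / 2 := by linarith
  have hprob := isProbabilityMeasure_stdLaw ha
  obtain ⟨K, s, hs, hK⟩ := exists_abs_effScore_sub_le k hν
  have hK' : ∀ (y : Fin k → ℝ), ∀ θ ∈ s, ‖effScore k θ.2.2 (localDist θ y) -
      effScore k (baseParam k ν).2.2 (localDist (baseParam k ν) y)‖ ≤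
        K * ‖θ - baseParam k ν‖ := by
    intro y θ hθ
    rw [baseParam_tail, Real.norm_eq_abs]
    exact hK θ hθ y
  have hbase : Integrable (fun y : Fin k → ℝ => effScore k (baseParam k ν).2.2
      (localDist (baseParam k ν) y)) (stdLaw k ((ν + k) / 2)) := by
    rw [baseParam_tail]
    exact integrable_effScore_base hν
  have hmeas : ∀ θ ∈ s, AEStronglyMeasurable (fun y : Fin k → ℝ =>
      effScore k θ.2.2 (localDist θ y)) (stdLaw k ((ν + k) / 2)) := fun θ _ =>
    (measurable_effScore _ (continuous_localDist θ).measurable).aestronglyMeasurable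
  have hmeas' := (continuous_fderiv_effScore (k := k) hν).aestronglyMeasurable
    (μ := stdLaw k ((ν + k) / 2))
  have hconst : Integrable (fun _ : Fin k → ℝ => K) (stdLaw k ((ν + k) / 2)) :=
    integrable_const K
  have hdiff : ∀ y : Fin k → ℝ, HasFDerivAt
      (fun θ : LocalParam k => effScore k θ.2.2 (localDist θ y))
      (fderiv ℝ (fun θ : LocalParam k => effScore k θ.2.2 (localDist θ y)) (baseParam k ν))
      (baseParam k ν) := fun y => (differentiableAt_effScore hν y).hasFDerivAt
  -- Differentiability is needed only at the base point, together with a Lipschitz bound between it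
  -- and its neighbours; the constant `K` is integrable because the law is a probability.
  obtain ⟨hint, hder⟩ := hasFDerivAt_integral_of_dominated_loc_of_lip' (𝕜 := ℝ)
    (μ := stdLaw k ((ν + k) / 2)) (x₀ := baseParam k ν) (s := s) (bound := fun _ => K)
    (F := fun (θ : LocalParam k) y => effScore k θ.2.2 (localDist θ y))
    (F' := fun y => fderiv ℝ (fun θ : LocalParam k => effScore k θ.2.2 (localDist θ y))
      (baseParam k ν)) hs hmeas hbase hmeas'
    (ae_of_all _ hK') hconst (ae_of_all _ hdiff)
  refine ⟨_, hder, fun v => ?_⟩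
  rw [ContinuousLinearMap.integral_apply hint, integral_fderiv_effScore hν, Gamma33Star_eq μ hS hν]

/-! ### Rate of the local parameters and concentration of normalized sums -/

/-- The local parameter of a Student law in the coordinates `x = μ + T y`. -/
noncomputable def localParam {k : ℕ} (μ : Fin k → ℝ) (T : Matrix (Fin k) (Fin k) ℝ)
    (μ' : Fin k → ℝ) (S' : Matrix (Fin k) (Fin k) ℝ) (ν' : ℝ) : LocalParam k :=
  (T⁻¹ *ᵥ (μ' - μ), fun i j => (Tᵀ * S'⁻¹ * T) i j, ν')

theorem localDist_localParam {k : ℕ} (μ : Fin k → ℝ) {T : Matrix (Fin k) (Fin k) ℝ}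
    (hT : T.det ≠ 0) (μ' : Fin k → ℝ) (S' : Matrix (Fin k) (Fin k) ℝ) (ν' : ℝ) (y : Fin k → ℝ) :
    localDist (localParam μ T μ' S' ν') y = ν' + mahalanobisSq μ' S' (μ + T *ᵥ y) := by
  have h : μ + T *ᵥ y - μ' = T *ᵥ (y - T⁻¹ *ᵥ (μ' - μ)) := by
    rw [Matrix.mulVec_sub, Matrix.mulVec_mulVec,
      Matrix.mul_nonsing_inv _ (isUnit_iff_ne_zero.2 hT), Matrix.one_mulVec]
    abel
  rw [mahalanobisSq, h, quadForm_mulVec]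
  rfl

theorem localParam_self {k : ℕ} (μ : Fin k → ℝ) {S T : Matrix (Fin k) (Fin k) ℝ} {ν : ℝ}
    (hν : 0 < ν) (hT : T.det ≠ 0) (hTS : T * Tᵀ = ν • S) :
    localParam μ T μ S ν = baseParam k ν := by
  rw [localParam, transpose_mul_inv_mul_eq hν hT hTS, baseParam, sub_self, Matrix.mulVec_zero]
  congr 2
  ext i j
  simp [Matrix.one_apply]

theorem isBigO_matrix_mul {k : ℕ} {A B : ℕ → Matrix (Fin k) (Fin k) ℝ} {f g : ℕ → ℝ}
    (hA : ∀ i j, (fun n => A n i j) =O[atTop] f) (hB : ∀ i j, (fun n => B n i j) =O[atTop] g)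
    (i j : Fin k) : (fun n => (A n * B n) i j) =O[atTop] fun n => f n * g n := by
  simp_rw [Matrix.mul_apply]
  exact Asymptotics.IsBigO.fun_sum fun l _ => (hA i l).mul (hB l j)

theorem isBigO_const_entry {k : ℕ} (A : Matrix (Fin k) (Fin k) ℝ) (i j : Fin k) :
    (fun _ : ℕ => A i j) =O[atTop] fun _ => (1 : ℝ) :=
  Asymptotics.isBigO_const_const _ one_ne_zero _

theorem isBigO_smul_of_bounded {u : ℕ → ℝ} {C : ℝ} (hu : ∀ n, |u n| ≤ C) :
    (fun n : ℕ => (√(n : ℝ))⁻¹ * u n) =O[atTop] fun n : ℕ => (√(n : ℝ))⁻¹ := by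
  have h : u =O[atTop] fun _ => (1 : ℝ) :=
    Asymptotics.IsBigO.of_bound C (Eventually.of_forall fun n => by simpa using hu n)
  simpa using (Asymptotics.isBigO_refl (fun n : ℕ => (√(n : ℝ))⁻¹) atTop).mul h

theorem tendsto_inv_sqrt : Tendsto (fun n : ℕ => (√(n : ℝ))⁻¹) atTop (𝓝 0) :=
  tendsto_inv_atTop_zero.comp (Real.tendsto_sqrt_atTop.comp tendsto_natCast_atTop_atTop)

theorem isBigO_localParam_sub {k : ℕ} (μ : Fin k → ℝ) {S T : Matrix (Fin k) (Fin k) ℝ} {ν : ℝ}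
    (hS : S.PosDef) (hν : 0 < ν) (hT : T.det ≠ 0) (hTS : T * Tᵀ = ν • S)
    {τ₁ : ℕ → Fin k → ℝ} {τ₂ : ℕ → Matrix (Fin k) (Fin k) ℝ} {τ₃ : ℕ → ℝ} {C : ℝ}
    (hτ : ∀ n, (∀ i, |τ₁ n i| ≤ C) ∧ (∀ i j, |τ₂ n i j| ≤ C) ∧ |τ₃ n| ≤ C)
    (hSτ : ∀ n : ℕ, 1 ≤ n → (S + (√(n : ℝ))⁻¹ • τ₂ n).PosDef) :
    (fun n : ℕ => localParam μ T (μ + (√(n : ℝ))⁻¹ • τ₁ n) (S + (√(n : ℝ))⁻¹ • τ₂ n)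
        (ν + (√(n : ℝ))⁻¹ * τ₃ n) - baseParam k ν) =O[atTop]
      fun n : ℕ => (√(n : ℝ))⁻¹ := by
  have hu : IsUnit S.det := isUnit_iff_ne_zero.2 hS.det_pos.ne'
  have hE : ∀ i j, (fun n : ℕ => ((√(n : ℝ))⁻¹ • τ₂ n) i j) =O[atTop]
      fun n : ℕ => (√(n : ℝ))⁻¹ := fun i j =>
    isBigO_smul_of_bounded (u := fun n => τ₂ n i j) fun n => (hτ n).2.1 i j
  have hlim : Tendsto (fun n : ℕ => S + (√(n : ℝ))⁻¹ • τ₂ n) atTop (𝓝 S) := by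
    refine tendsto_pi_nhds.2 fun i => tendsto_pi_nhds.2 fun j => ?_
    have h := ((hE i j).trans_tendsto tendsto_inv_sqrt).const_add (S i j)
    simpa using h
  -- The perturbed matrices converge to `S`, and continuity of inversion there bounds their
  -- inverses.
  have hinv : ∀ i j, (fun n : ℕ => (S + (√(n : ℝ))⁻¹ • τ₂ n)⁻¹ i j) =O[atTop]
      fun _ => (1 : ℝ) := by
    intro i j
    have h := (continuousAt_matrix_inv hS.det_pos.ne').tendsto.comp hlim
    exact (((tendsto_pi_nhds.1 ((tendsto_pi_nhds.1 h) i)) j)).isBigO_one ℝ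
  rw [← localParam_self μ hν hT hTS]
  refine Asymptotics.IsBigO.prod_left ?_ (Asymptotics.IsBigO.prod_left ?_ ?_)
  · rw [Asymptotics.isBigO_pi]
    intro i
    simp only [localParam, add_sub_cancel_left, sub_self, Matrix.mulVec_zero, sub_zero,
      Matrix.mulVec, dotProduct]
    refine Asymptotics.IsBigO.fun_sum fun j _ => ?_
    exact (isBigO_smul_of_bounded (u := fun n => τ₁ n j) fun n => (hτ n).1 j).const_mul_left _
  · rw [Asymptotics.isBigO_pi]
    intro i
    rw [Asymptotics.isBigO_pi]
    intro j
    have h1 := isBigO_matrix_mul (isBigO_matrix_mul (isBigO_matrix_mul (isBigO_matrix_mul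
      (isBigO_const_entry Tᵀ) hinv) hE) (isBigO_const_entry S⁻¹)) (isBigO_const_entry T) i j
    simp only [one_mul, mul_one] at h1
    refine (h1.neg_left).congr' ?_ EventuallyEq.rfl
    filter_upwards [eventually_ge_atTop 1] with n hn
    have hun : IsUnit (S + (√(n : ℝ))⁻¹ • τ₂ n).det :=
      isUnit_iff_ne_zero.2 (hSτ n hn).det_pos.ne'
    set R := S + (√(n : ℝ))⁻¹ • τ₂ n with hR
    have e1 : (√(n : ℝ))⁻¹ • τ₂ n = R - S := by rw [hR, add_sub_cancel_left]
    -- The resolvent identity turns the difference of precisions into a product with the factor `R -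
    -- S` of order `n^{-1/2}`.
    have e2 : R⁻¹ * (R - S) * S⁻¹ = S⁻¹ - R⁻¹ := by
      rw [Matrix.mul_sub, Matrix.nonsing_inv_mul _ hun, Matrix.sub_mul, Matrix.one_mul,
        Matrix.mul_assoc, Matrix.mul_nonsing_inv _ hu, Matrix.mul_one]
    have e3 : Tᵀ * R⁻¹ * (R - S) * S⁻¹ * T = Tᵀ * S⁻¹ * T - Tᵀ * R⁻¹ * T := by
      rw [Matrix.mul_assoc Tᵀ, Matrix.mul_assoc Tᵀ, e2, Matrix.mul_sub, Matrix.sub_mul]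
    rw [e1, e3]
    simp [localParam]
  · have h := isBigO_smul_of_bounded (u := τ₃) fun n => (hτ n).2.2
    simpa [localParam] using h

/-- Chebyshev's inequality for normalized sums of uniformly small summands. -/
theorem tendsto_measure_normalized_sum {Ω : Type*} {mΩ : MeasurableSpace Ω} (P : Measure Ω)
    [IsProbabilityMeasure P] {g : ℕ → Ω → ℝ} {B e : ℕ → ℝ} (hg : ∀ n, Measurable (g n))
    (hB : ∀ᶠ n in atTop, ∀ x, |g n x| ≤ B n) (hB0 : Tendsto B atTop (𝓝 0))
    (he : Tendsto (fun n : ℕ => √(n : ℝ) * (∫ x, g n x ∂P) + e n) atTop (𝓝 0)) {ε : ℝ}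
    (hε : 0 < ε) :
    Tendsto (fun n : ℕ => Measure.pi (fun _ : Fin n => P)
      {X | ε ≤ |(√(n : ℝ))⁻¹ * ∑ i, g n (X i) + e n|}) atTop (𝓝 0) := by
  have hlim : Tendsto (fun n => ENNReal.ofReal (B n ^ 2 / (ε / 2) ^ 2)) atTop (𝓝 0) := by
    have h : Tendsto (fun n => B n ^ 2 / (ε / 2) ^ 2) atTop (𝓝 0) := by
      simpa using (hB0.pow 2).div_const ((ε / 2) ^ 2)
    simpa using ENNReal.tendsto_ofReal h
  refine tendsto_of_tendsto_of_tendsto_of_le_of_le' tendsto_const_nhds hlim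
    (Eventually.of_forall fun n => zero_le) ?_
  have hsmall := he.abs.eventually (gt_mem_nhds (show |(0 : ℝ)| < ε / 2 by simpa using half_pos hε))
  filter_upwards [hB, hsmall, eventually_ge_atTop 1] with n hBn hen hn
  have hn0 : (0 : ℝ) < n := by exact_mod_cast hn
  have hsq : 0 < √(n : ℝ) := Real.sqrt_pos.2 hn0
  have hmem : MemLp (g n) 2 P :=
    MemLp.of_bound (hg n).aestronglyMeasurable (B n) (Eventually.of_forall hBn)
  have hmemi : ∀ i : Fin n, MemLp (fun X : Fin n → Ω => g n (X i)) 2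
      (Measure.pi fun _ : Fin n => P) := fun i =>
    hmem.comp_measurePreserving (measurePreserving_eval (fun _ : Fin n => P) i)
  set W : (Fin n → Ω) → ℝ := fun X => (√(n : ℝ))⁻¹ * ∑ i, g n (X i) with hW
  have hWmem : MemLp W 2 (Measure.pi fun _ : Fin n => P) :=
    (memLp_finsetSum _ fun i _ => hmemi i).const_mul _
  have hmean : ∫ X, W X ∂(Measure.pi fun _ : Fin n => P) = √(n : ℝ) * ∫ x, g n x ∂P := by
    simp only [hW]
    rw [integral_const_mul, integral_finsetSum _ fun i _ => (hmemi i).integrable one_le_two]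
    have h1 : ∀ i : Fin n, ∫ X : Fin n → Ω, g n (X i) ∂(Measure.pi fun _ : Fin n => P) =
        ∫ x, g n x ∂P := fun i =>
      integral_comp_eval (μ := fun _ : Fin n => P) (hg n).aestronglyMeasurable
    simp_rw [h1]
    rw [Finset.sum_const, Finset.card_univ, Fintype.card_fin, nsmul_eq_mul, ← mul_assoc]
    congr 1
    rw [inv_mul_eq_div, Real.div_sqrt]
  -- By independence the normalization cancels the number of summands, leaving the variance of one
  -- summand.
  have hvar : Var[W; Measure.pi fun _ : Fin n => P] ≤ B n ^ 2 := by
    have h1 : Var[fun X : Fin n → Ω => ∑ i, g n (X i); Measure.pi fun _ : Fin n => P] =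
        n * Var[g n; P] := by
      have h := variance_sum_pi (μ := fun _ : Fin n => P) (X := fun _ => g n) fun _ => hmem
      rw [Finset.sum_const, Finset.card_univ, Fintype.card_fin, nsmul_eq_mul] at h
      rw [← h]
      congr 1
      ext X
      simp
    have h2 : Var[g n; P] ≤ B n ^ 2 := by
      refine (variance_le_expectation_sq (hg n).aestronglyMeasurable).trans ?_
      have h3 : ∫ x, (g n ^ 2) x ∂P ≤ ∫ _x, B n ^ 2 ∂P := by
        refine integral_mono hmem.integrable_sq (integrable_const _) fun x => ?_
        exact sq_le_sq' (abs_le.1 (hBn x)).1 (abs_le.1 (hBn x)).2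
      simpa using h3
    rw [hW, variance_const_mul, h1, inv_pow, Real.sq_sqrt hn0.le, ← mul_assoc,
      inv_mul_cancel₀ hn0.ne', one_mul]
    exact h2
  -- Half of `ε` absorbs the bias, mean plus `e n`, which is eventually below `ε / 2`; the other
  -- half is left for the fluctuation.
  have hsub : {X | ε ≤ |W X + e n|} ⊆
      {X | ε / 2 ≤ |W X - ∫ X, W X ∂(Measure.pi fun _ : Fin n => P)|} := by
    intro X hX
    simp only [Set.mem_ofPred_eq] at hX ⊢
    rw [hmean]
    have h := abs_add_le (W X - √(n : ℝ) * ∫ x, g n x ∂P) (√(n : ℝ) * (∫ x, g n x ∂P) + e n)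
    rw [show W X - √(n : ℝ) * ∫ x, g n x ∂P + (√(n : ℝ) * (∫ x, g n x ∂P) + e n) =
      W X + e n by ring] at h
    linarith
  refine (measure_mono hsub).trans ((meas_ge_le_variance_div_sq hWmem (half_pos hε)).trans ?_)
  gcongr

end StudentT

/-! ### Asymptotic linearity of the efficient central sequence -/

theorem lemma1 {k : ℕ} (μ : Fin k → ℝ) (S : Matrix (Fin k) (Fin k) ℝ) (ν : ℝ)
    (hS : S.PosDef) (hν : 0 < ν)
    (τ₁ : ℕ → Fin k → ℝ) (τ₂ : ℕ → Matrix (Fin k) (Fin k) ℝ) (τ₃ : ℕ → ℝ)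
    (hτ : ∃ C : ℝ, ∀ n, (∀ i, |τ₁ n i| ≤ C) ∧ (∀ i j, |τ₂ n i j| ≤ C) ∧ |τ₃ n| ≤ C)
    (hSτ : ∀ n : ℕ, 1 ≤ n → (S + (√(n : ℝ))⁻¹ • τ₂ n).PosDef)
    (hντ : ∀ n : ℕ, 1 ≤ n → 0 < ν + (√(n : ℝ))⁻¹ * τ₃ n) :
    StudentT.IsLittleOP (fun n => StudentT.sampleLaw n μ S ν)
      (fun n X =>
        StudentT.Delta3Star n (μ + (√(n : ℝ))⁻¹ • τ₁ n) (S + (√(n : ℝ))⁻¹ • τ₂ n)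
            (ν + (√(n : ℝ))⁻¹ * τ₃ n) X
          - (StudentT.Delta3Star n μ S ν X - StudentT.Gamma33Star μ S ν * τ₃ n))
    ∧ ((∀ n : ℕ, 1 ≤ n → τ₃ n = 0) →
      StudentT.IsLittleOP (fun n => StudentT.sampleLaw n μ S ν)
        (fun n X =>
          StudentT.Delta3Star n (μ + (√(n : ℝ))⁻¹ • τ₁ n) (S + (√(n : ℝ))⁻¹ • τ₂ n) ν X
            - StudentT.Delta3Star n μ S ν X)) := by
  have main : StudentT.IsLittleOP (fun n => StudentT.sampleLaw n μ S ν)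
      (fun n X =>
        StudentT.Delta3Star n (μ + (√(n : ℝ))⁻¹ • τ₁ n) (S + (√(n : ℝ))⁻¹ • τ₂ n)
            (ν + (√(n : ℝ))⁻¹ * τ₃ n) X
          - (StudentT.Delta3Star n μ S ν X - StudentT.Gamma33Star μ S ν * τ₃ n)) := by
    intro ε hε
    obtain ⟨C, hC⟩ := hτ
    obtain ⟨T, hT, hTS⟩ := StudentT.exists_mul_transpose_eq (hS.smul hν)
    have hprob := StudentT.isProbabilityMeasure_law μ hS hν
    have hstd := StudentT.isProbabilityMeasure_stdLaw (k := k) (a := (ν + k) / 2) (by linarith)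
    set θ : ℕ → StudentT.LocalParam k := fun n =>
      StudentT.localParam μ T (μ + (√(n : ℝ))⁻¹ • τ₁ n) (S + (√(n : ℝ))⁻¹ • τ₂ n)
        (ν + (√(n : ℝ))⁻¹ * τ₃ n) with hθ
    have hO : (fun n => θ n - StudentT.baseParam k ν) =O[atTop] fun n : ℕ => (√(n : ℝ))⁻¹ :=
      StudentT.isBigO_localParam_sub μ hS hν hT hTS hC hSτ
    have hθlim : Tendsto θ atTop (𝓝 (StudentT.baseParam k ν)) := by
      simpa using (hO.trans_tendsto StudentT.tendsto_inv_sqrt).add_const (StudentT.baseParam k ν)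
    obtain ⟨K, s, hs, hK⟩ := StudentT.exists_abs_effScore_sub_le k hν
    obtain ⟨D, hD, hDv⟩ := StudentT.exists_hasFDerivAt_meanScore μ hS hν
    set g : ℕ → (Fin k → ℝ) → ℝ := fun n x =>
      StudentT.effScore k (ν + (√(n : ℝ))⁻¹ * τ₃ n) ((ν + (√(n : ℝ))⁻¹ * τ₃ n) +
        StudentT.mahalanobisSq (μ + (√(n : ℝ))⁻¹ • τ₁ n) (S + (√(n : ℝ))⁻¹ • τ₂ n) x) -
      StudentT.effScore k ν (ν + StudentT.mahalanobisSq μ S x) with hg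
    have hgm : ∀ n, Measurable (g n) := fun n =>
      (StudentT.measurable_effScore _
        ((StudentT.continuous_mahalanobisSq _ _).measurable.const_add _)).sub
      (StudentT.measurable_effScore _
        ((StudentT.continuous_mahalanobisSq _ _).measurable.const_add _))
    have hgy : ∀ n y, g n (μ + T *ᵥ y) = StudentT.effScore k (θ n).2.2
        (StudentT.localDist (θ n) y) -
        StudentT.effScore k ν (StudentT.localDist (StudentT.baseParam k ν) y) := by
      intro n y
      rw [← StudentT.localParam_self μ hν hT hTS, StudentT.localDist_localParam μ hT]
      simp only [hθ]
      rw [StudentT.localDist_localParam μ hT]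
      rfl
    have hθs : ∀ᶠ n in atTop, θ n ∈ s := hθlim.eventually hs
    have hbound : ∀ᶠ n in atTop, ∀ x, |g n x| ≤ K * ‖θ n - StudentT.baseParam k ν‖ := by
      filter_upwards [hθs] with n hn x
      -- The affine map is onto, so the uniform bound in standardized coordinates holds at every
      -- observation.
      have hx : x = μ + T *ᵥ (T⁻¹ *ᵥ (x - μ)) := by
        rw [Matrix.mulVec_mulVec, Matrix.mul_nonsing_inv _ (isUnit_iff_ne_zero.2 hT),
          Matrix.one_mulVec, add_sub_cancel]
      rw [hx, hgy]
      exact hK _ hn _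
    have hB0 : Tendsto (fun n => K * ‖θ n - StudentT.baseParam k ν‖) atTop (𝓝 0) := by
      have := (hO.trans_tendsto StudentT.tendsto_inv_sqrt).norm.const_mul K
      simpa using this
    have hmean : ∀ᶠ n in atTop, ∫ x, g n x ∂(StudentT.law μ S ν) =
        StudentT.meanScore k ν (θ n) - StudentT.meanScore k ν (StudentT.baseParam k ν) := by
      filter_upwards [hθs] with n hn
      have h0 := StudentT.integrable_effScore_base (k := k) hν
      have hdiff : Integrable (fun y => StudentT.effScore k (θ n).2.2
          (StudentT.localDist (θ n) y) -
          StudentT.effScore k ν (StudentT.localDist (StudentT.baseParam k ν) y))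
          (StudentT.stdLaw k ((ν + k) / 2)) :=
        Integrable.of_bound ((StudentT.measurable_effScore _
          (StudentT.continuous_localDist _).measurable).sub (StudentT.measurable_effScore _
          (StudentT.continuous_localDist _).measurable)).aestronglyMeasurable _
          (Eventually.of_forall fun y => hK _ hn y)
      have h1 : Integrable (fun y => StudentT.effScore k (θ n).2.2
          (StudentT.localDist (θ n) y)) (StudentT.stdLaw k ((ν + k) / 2)) := by
        exact (hdiff.add h0).congr (Eventually.of_forall fun y => sub_add_cancel _ _)
      rw [StudentT.law_eq_map μ hS hν hT hTS,
        integral_map (StudentT.measurable_affine μ T).aemeasurable (hgm n).aestronglyMeasurable]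
      simp_rw [hgy]
      rw [integral_sub h1 h0]
      rfl
    have hlim : Tendsto (fun n : ℕ => √(n : ℝ) * (∫ x, g n x ∂(StudentT.law μ S ν)) +
        StudentT.Gamma33Star μ S ν * τ₃ n) atTop (𝓝 0) := by
      -- The remainder of the expansion of the mean is `o(‖θₙ - θ₀‖)`, hence `o(n^{-1/2})`; dividing
      -- by `n^{-1/2}` gives the limit.
      have h1 := (hD.isLittleO.comp_tendsto hθlim).trans_isBigO hO
      have h2 := (Asymptotics.isLittleO_iff_tendsto' (by
        filter_upwards [eventually_ge_atTop 1] with n hn h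
        have : (0 : ℝ) < n := by exact_mod_cast hn
        exact absurd h (inv_pos.2 (Real.sqrt_pos.2 this)).ne')).1 h1
      refine h2.congr' ?_
      filter_upwards [hmean, eventually_ge_atTop 1] with n hn hn1
      have hn0 : (0 : ℝ) < n := by exact_mod_cast hn1
      have hsq : 0 < √(n : ℝ) := Real.sqrt_pos.2 hn0
      have h3 : (θ n - StudentT.baseParam k ν).2.2 = (√(n : ℝ))⁻¹ * τ₃ n := by
        simp [hθ, StudentT.localParam, StudentT.baseParam]
      rw [hn]
      simp only [Function.comp]
      rw [hDv, h3]
      field_simp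
      ring
    have hfin := StudentT.tendsto_measure_normalized_sum (StudentT.law μ S ν) hgm hbound hB0 hlim hε
    refine hfin.congr' ?_
    -- The closed form of the central sequence requires admissible perturbed parameters, which are
    -- guaranteed from `n = 1` on.
    filter_upwards [eventually_ge_atTop 1] with n hn
    rw [StudentT.sampleLaw]
    congr 1
    ext X
    simp only [Set.mem_ofPred_eq]
    rw [StudentT.Delta3Star_eq _ (hSτ n hn) (hντ n hn), StudentT.Delta3Star_eq _ hS hν]
    simp only [hg]
    rw [Finset.sum_sub_distrib]
    ring_nf
  refine ⟨main, fun h0 ε hε => (main ε hε).congr' ?_⟩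
  filter_upwards [eventually_ge_atTop 1] with n hn
  simp [h0 n hn]
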